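/- Let $K$ be a finite connected cell complex (finite connected CW complex), let $p$ be a prime and let $\mathbb F_p$ be the field of order $p$. Call a group *large* if some finite index subgroup of it admits a surjective homomorphism onto a non-abelian free group. Consider the following three conclusions: (a) $\pi_1(K)$ admits a surjective homomorphism onto $(\mathbb Z/p\mathbb Z) * (\mathbb Z/p\mathbb Z)$; (b) some normal subgroup of $\pi_1(K)$, with index a power of $p$, admits a surjective homomorphism onto a non-abelian free group; (c) $\pi_1(K)$ is large. (1) Let $A$ and $B$ be subcomplexes of $K$ such that $K = A \cup B$. Suppose that neither of the maps $H^1(A;\mathbb F_p) \to H^1(A\cap B;\mathbb F_p)$ and $H^1(B;\mathbb F_p) \to H^1(A\cap B;\mathbb F_p)$ induced by inclusion is injective. In the case $p=2$, suppose also that the kernel of at least one of these maps has dimension greater than one. Then (a), (b) and (c) hold. (2) Let the mod $p$ Cheeger constant of $K$ be $$h_p(K) = \inf \left\{ \frac{|H_1(A\cap B;\mathbb F_p)|}{\min\{|H_1(A;\mathbb F_p)|, |H_1(B;\mathbb F_p)|\}} \right\},$$ where the infimum is over all decompositions $K = A\cup B$ in which $A$ and $B$ are subcomplexes of some finite subdivision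 of the cell structure on $K$ (a subdivision is a cell structure on the same space each of whose open cells lies in an open cell of the original one). If $h_p(K) < 1$ and $p$ is odd, or if $h_p(K) < 1/2$ and $p = 2$, then (a), (b) and (c) hold. -/

import Mathlib

universe u

open CategoryTheory
open scoped ENNReal

noncomputable section

namespace LargeGroups

/-! ### Mod `p` singular homology and cohomology in degree one -/

/-- The coefficient module `𝔽_p` (lifted to the universe of the spaces under consideration). -/
abbrev coeff (p : ℕ) : ModuleCat.{u} (ZMod p) := ModuleCat.of (ZMod p) (ULift.{u} (ZMod p))

/-- The functor of singular chains with coefficients in `𝔽_p`. -/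
abbrev singularChains (p : ℕ) : TopCat.{u} ⥤ ChainComplex (ModuleCat.{u} (ZMod p)) ℕ :=
  (AlgebraicTopology.singularChainComplexFunctor (ModuleCat.{u} (ZMod p))).obj (coeff.{u} p)

/-- The contravariant functor of singular cochains with coefficients in `𝔽_p`, that is,
`X ↦ Hom(C_•(X; 𝔽_p), 𝔽_p)`. -/
def singularCochains (p : ℕ) : TopCat.{u}ᵒᵖ ⥤ CochainComplex (ModuleCat.{u} (ZMod p)) ℕ :=
  (singularChains.{u} p ⋙
      ((linearYoneda (ZMod p) (ModuleCat.{u} (ZMod p))).obj (coeff.{u} p)).rightOp.mapHomologicalComplex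
        (ComplexShape.down ℕ)).op ⋙
    HomologicalComplex.unopFunctor (ModuleCat.{u} (ZMod p)) (ComplexShape.down ℕ)

/-- The functor `X ↦ H¹(X; 𝔽_p)` (singular cohomology). -/
def cohomologyOne (p : ℕ) : TopCat.{u}ᵒᵖ ⥤ ModuleCat.{u} (ZMod p) :=
  singularCochains.{u} p ⋙
    HomologicalComplex.homologyFunctor (ModuleCat.{u} (ZMod p)) (ComplexShape.up ℕ) 1

/-- `H₁(S; 𝔽_p)` (singular homology) of a subspace `S`. -/
abbrev H₁ (p : ℕ) {X : Type u} [TopologicalSpace X] (S : Set X) : ModuleCat.{u} (ZMod p) :=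
  ((AlgebraicTopology.singularHomologyFunctor (ModuleCat.{u} (ZMod p)) 1).obj (coeff.{u} p)).obj
    (TopCat.of S)

/-- `H¹(S; 𝔽_p)` (singular cohomology) of a subspace `S`. -/
abbrev H1 (p : ℕ) {X : Type u} [TopologicalSpace X] (S : Set X) : ModuleCat.{u} (ZMod p) :=
  (cohomologyOne.{u} p).obj (Opposite.op (TopCat.of S))

/-- The map `H¹(T; 𝔽_p) → H¹(S; 𝔽_p)` induced by an inclusion `S ⊆ T` of subspaces. -/
def restrict (p : ℕ) {X : Type u} [TopologicalSpace X] {S T : Set X} (h : S ⊆ T) :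
    H1 p T →ₗ[ZMod p] H1 p S :=
  ((cohomologyOne.{u} p).map
    (TopCat.ofHom (⟨Set.inclusion h, continuous_inclusion h⟩ : C(S, T))).op).hom

/-! ### Subdivisions and the mod `p` Cheeger constant -/

/-- The open cells of a CW structure on the space `X`. -/
def openCells {X : Type u} [TopologicalSpace X]
    (𝒞 : Topology.CWComplex (Set.univ : Set X)) : Set (Set X) :=
  {U | ∃ (n : ℕ) (e : Topology.RelCWComplex.cell (Set.univ : Set X) n),
    U = Topology.RelCWComplex.openCell n e}

/-- A CW structure `𝒞'` on `X` is a subdivision of the CW structure `𝒞` if each open cell of `𝒞'`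
is contained in an open cell of `𝒞`. -/
def IsSubdivision {X : Type u} [TopologicalSpace X]
    (𝒞' 𝒞 : Topology.CWComplex (Set.univ : Set X)) : Prop :=
  ∀ U' ∈ openCells 𝒞', ∃ U ∈ openCells 𝒞, U' ⊆ U

/-- `A` and `B` are (the underlying sets of) subcomplexes of the CW structure `𝒞` on `X`,
with `X = A ∪ B`. -/
def IsDecomposition {X : Type u} [TopologicalSpace X]
    (𝒞 : Topology.CWComplex (Set.univ : Set X)) (A B : Set X) : Prop :=
  (∃ E : Topology.CWComplex.Subcomplex (Set.univ : Set X), (E : Set X) = A) ∧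
  (∃ E : Topology.CWComplex.Subcomplex (Set.univ : Set X), (E : Set X) = B) ∧
  A ∪ B = Set.univ

/-- The CW structure `𝒞` on `X` has only finitely many cells. -/
def IsFiniteCW {X : Type u} [TopologicalSpace X]
    (𝒞 : Topology.CWComplex (Set.univ : Set X)) : Prop :=
  Topology.CWComplex.Finite (Set.univ : Set X)

/-- The mod `p` Cheeger constant of a finite CW complex: the infimum of
`|H₁(A ∩ B; 𝔽_p)| / min {|H₁(A; 𝔽_p)|, |H₁(B; 𝔽_p)|}` over all decompositions of `X` into two
subcomplexes `A`, `B` of some (finite) subdivision of the CW structure. The homology groups here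
are those of finite CW complexes, hence finite, so the clause `Finite (H₁ p (A ∩ B))` excludes
no decomposition; it only makes visible that the quotient is never of the form `∞ / ∞`. -/
def cheegerConstant (p : ℕ) {X : Type u} [TopologicalSpace X]
    (𝒞 : Topology.CWComplex (Set.univ : Set X)) : ℝ≥0∞ :=
  sInf {r : ℝ≥0∞ | ∃ (𝒞' : Topology.CWComplex (Set.univ : Set X)) (A B : Set X),
    IsFiniteCW 𝒞' ∧ IsSubdivision 𝒞' 𝒞 ∧ IsDecomposition 𝒞' A B ∧ Finite (H₁ p (A ∩ B : Set X)) ∧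
    r = (ENat.card (H₁ p (A ∩ B : Set X)) : ℝ≥0∞) /
      min (ENat.card (H₁ p A) : ℝ≥0∞) (ENat.card (H₁ p B) : ℝ≥0∞)}

/-! ### Groups -/

/-- The group `G` admits a surjective homomorphism onto a non-abelian free group
(a free group on a set with at least two elements). -/
def SurjectsOntoNonabelianFree (G : Type u) [Group G] : Prop :=
  ∃ (α : Type) (_ : Nontrivial α) (f : G →* FreeGroup α), Function.Surjective f

/-- A group is large if some finite index subgroup surjects onto a non-abelian free group. -/
def IsLarge (G : Type u) [Group G] : Prop :=
  ∃ H : Subgroup G, H.FiniteIndex ∧ SurjectsOntoNonabelianFree H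

/-- `G` surjects onto `ℤ/p * ℤ/p`, some normal subgroup of `G` whose index is a power of `p`
surjects onto a non-abelian free group, and `G` is large. -/
def IsLargeMod (p : ℕ) (G : Type u) [Group G] : Prop :=
  (∃ f : G →* Monoid.Coprod (Multiplicative (ZMod p)) (Multiplicative (ZMod p)),
    Function.Surjective f) ∧
  (∃ N : Subgroup G, N.Normal ∧ (∃ k : ℕ, N.index = p ^ k) ∧ SurjectsOntoNonabelianFree N) ∧
  IsLarge G

end LargeGroups

end

/-!
A class in the kernel of `H¹(A; 𝔽_p) → H¹(A ∩ B; 𝔽_p)` is represented by a singular cocycle of `A`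
that vanishes on the loops of `A ∩ B`. Evaluated on paths, and corrected by the coboundary of a
function on `A`, it becomes a labelling of the paths of `A` by elements of `V = 𝔽_p` that is zero on
all paths of `A ∩ B`. Restricted to a path component of `A` with a loop of nonzero label, and put
equal to zero elsewhere, it takes every value on the loops of that component, so that points in one
path component of `A` are always joined by a path with label zero: a *full labelling*
(`exists_isFullLabelling`). Two linearly independent classes give a full labelling
with values in `V = 𝔽_p × 𝔽_p`, where the two coordinates may have to be supported on different path
components (`exists_isFullLabelling_prod`).

Labellings of `A` in `V` and of `B` in `W` both vanish on `A ∩ B`, so by van Kampen's theorem they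
define a homomorphism `π₁(K) → V * W`. The form of that theorem that is needed is `exists_transport`:
cocycles on the paths of the pieces of a finite closed cover, with agreeing values on common paths,
extend to a homotopy invariant functor on all paths of the space. It is proved by gluing: as the
pieces and their intersections are locally contractible (`isLocallyContractible_of_finite`), the
cocycles have local potentials, from which a covering space with fibre the group is assembled, and
the functor is the lifting of paths to this covering. Fullness of the labellings makes
`π₁(K) → V * W` surjective (`exists_surjective_coprod`).

If `V` and `W` are nontrivial finite `p`-groups and not both of order two, the kernel of
`V * W → V × W` maps onto a free group of rank at least two (it is itself free), and its preimage in
`π₁(K)` has index a power of `p`. This gives the result directly if `p` is odd, and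
for `p = 2` if one of the two labellings takes values in `𝔽_2 × 𝔽_2` (`isLargeMod_of_surjective`).

For the Cheeger constant, a decomposition with `|H₁(A ∩ B)| < |H₁(A)|` admits a nonzero linear form
on `H₁(A)` that vanishes on the image of `H₁(A ∩ B)`; if `2 |H₁(A ∩ B)| < |H₁(A)|` and `p = 2`, it
admits two linearly independent ones. Such forms extend to cocycles to which the same argument
applies (`exists_relativeCocycle_of_homology`), so that no universal coefficient theorem is needed.
-/

/-! ### Local contractibility of finite CW complexes -/

noncomputable section

open Set Filter Topology Metric

namespace LargeGroups

/-- A subset `C` of a topological space is locally contractible: each neighbourhood `U` of a point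
of `C` contains a smaller one `V` such that the inclusion `V ∩ C ⊆ U ∩ C` is null-homotopic. The
homotopy is a map on the ambient spaces of which only the restriction to `[0, 1] × (V ∩ C)`
matters. -/
def IsLocallyContractible {X : Type*} [TopologicalSpace X] (C : Set X) : Prop :=
  ∀ y ∈ C, ∀ U ∈ 𝓝 y, ∃ V ∈ 𝓝 y, ∃ (H : ℝ × X → X) (w : X),
    ContinuousOn H (Icc 0 1 ×ˢ (V ∩ C)) ∧
    ∀ z ∈ V ∩ C, H (0, z) = z ∧ H (1, z) = w ∧ ∀ t ∈ Icc (0 : ℝ) 1, H (t, z) ∈ U ∩ C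

/-- A continuous map from a compact set to a Hausdorff space is closed; in terms of filters, a
neighbourhood of a fibre contains all fibres over some neighbourhood. -/
theorem eventually_of_isCompact {P Y : Type*} [TopologicalSpace P] [TopologicalSpace Y] [T2Space Y]
    {K : Set P} (hK : IsCompact K) {g : P → Y} (hg : ContinuousOn g K) {y : Y} {S : Set P}
    (h : ∀ k ∈ K, g k = y → S ∈ 𝓝[K] k) : ∀ᶠ z in 𝓝 y, ∀ k ∈ K, g k = z → k ∈ S := by
  by_contra hcon
  rw [not_eventually] at hcon
  have hne : (𝓝 y ⊓ 𝓟 (g '' (K \ S))).NeBot := by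
    rw [inf_principal_neBot_iff]
    intro U hU
    obtain ⟨z, hz, hzU⟩ := (hcon.and_eventually hU).exists
    push Not at hz
    obtain ⟨k, hk, rfl, hkS⟩ := hz
    exact ⟨_, hzU, k, ⟨hk, hkS⟩, rfl⟩
  have hne' : (comap g (𝓝 y) ⊓ 𝓟 (K \ S)).NeBot := by
    rw [inf_principal_neBot_iff]
    rintro U ⟨W, hW, hWU⟩
    obtain ⟨z, hzW, k, hk, rfl⟩ := inf_principal_neBot_iff.1 hne W hW
    exact ⟨k, hWU hzW, hk⟩
  let v := Ultrafilter.of (comap g (𝓝 y) ⊓ 𝓟 (K \ S))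
  have hv : (v : Filter P) ≤ comap g (𝓝 y) ⊓ 𝓟 (K \ S) := Ultrafilter.of_le _
  have hvK : (v : Filter P) ≤ 𝓟 (K \ S) := hv.trans inf_le_right
  have hvK' : K \ S ∈ v := by simpa using hvK
  obtain ⟨k, hk, hvk⟩ := hK.ultrafilter_le_nhds v (hvK.trans (by simp))
  have hvk' : (v : Filter P) ≤ 𝓝[K] k := le_inf hvk (hvK.trans (by simp))
  have h1 : Tendsto g v (𝓝 (g k)) := (hg k hk).mono_left hvk'
  have h2 : Tendsto g v (𝓝 y) := tendsto_iff_comap.2 (hv.trans inf_le_left)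
  have h3 := h k hk (tendsto_nhds_unique h1 h2)
  obtain ⟨x, hx, hx'⟩ := v.nonempty_of_mem (inter_mem (hvk' h3) hvK')
  exact hx'.2 hx

theorem continuousWithinAt_of_isCompact {P Y Z : Type*} [TopologicalSpace P] [TopologicalSpace Y]
    [T2Space Y] [TopologicalSpace Z] {K : Set P} (hK : IsCompact K) {g : P → Y}
    (hg : ContinuousOn g K) {s : Set Y} (hs : s ⊆ g '' K) {R : Y → Z} {y : Y}
    (h : ∀ k ∈ K, g k = y → ContinuousWithinAt (R ∘ g) (K ∩ g ⁻¹' s) k) :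
    ContinuousWithinAt R s y := by
  intro O hO
  rw [mem_map]
  have := eventually_of_isCompact hK hg (y := y) (S := {k | g k ∈ s → R (g k) ∈ O}) (by
    intro k hk hky
    have h1 := h k hk hky
    have h2 : (R ∘ g) ⁻¹' O ∈ 𝓝[K ∩ g ⁻¹' s] k := h1 (by simpa [hky] using hO)
    rw [mem_nhdsWithin_iff_eventually] at h2 ⊢
    filter_upwards [h2] with x hx hxK hxs using hx ⟨hxK, hxs⟩)
  rw [mem_nhdsWithin_iff_eventually]
  filter_upwards [this] with z hz hzs
  obtain ⟨k, hk, rfl⟩ := hs hzs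
  exact hz k hk rfl hzs

section AttachCell

theorem mem_sphere_of_map_mem {X E : Type*} [NormedAddCommGroup E] {D : Set X}
    {Φ : PartialEquiv E X} (hdis : Disjoint (Φ '' ball 0 1) D) {v : E}
    (hv : v ∈ closedBall (0 : E) 1) (h : Φ v ∈ D) : v ∈ sphere (0 : E) 1 := by
  by_contra hvs
  refine disjoint_left.1 hdis ⟨v, ?_, rfl⟩ h
  rw [← ball_union_sphere] at hv
  exact hv.resolve_right hvs

theorem mem_ball_of_map_notMem {X E : Type*} [NormedAddCommGroup E] {D : Set X}
    {Φ : PartialEquiv E X} (hfr : MapsTo Φ (sphere 0 1) D) {v : E}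
    (hv : v ∈ closedBall (0 : E) 1) (h : Φ v ∉ D) : v ∈ ball (0 : E) 1 := by
  rw [← ball_union_sphere] at hv
  exact hv.resolve_right fun hvs => h (hfr hvs)

variable {X : Type*} [TopologicalSpace X] [T2Space X] {E : Type*} [NormedAddCommGroup E]
  [NormedSpace ℝ E] {D : Set X} {Φ : PartialEquiv E X}

/-- Local contractibility at the points of an open cell: contract a small ball linearly. -/
theorem exists_contraction_of_mem_openCell [ProperSpace E] (hD : IsClosed D)
    (hs : Φ.source = ball 0 1) (hc : ContinuousOn Φ (closedBall 0 1))
    (hc' : ContinuousOn Φ.symm Φ.target) (hfr : MapsTo Φ (sphere 0 1) D)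
    (hdis : Disjoint (Φ '' ball 0 1) D) {v₀ : E} (hv₀ : v₀ ∈ ball (0 : E) 1)
    {U : Set X} (hU : U ∈ 𝓝 (Φ v₀)) :
    ∃ V ∈ 𝓝 (Φ v₀), ∃ (H : ℝ × X → X) (w : X),
      ContinuousOn H (Icc 0 1 ×ˢ (V ∩ (D ∪ Φ '' closedBall 0 1))) ∧
      ∀ z ∈ V ∩ (D ∪ Φ '' closedBall 0 1), H (0, z) = z ∧ H (1, z) = w ∧
        ∀ t ∈ Icc (0 : ℝ) 1, H (t, z) ∈ U ∩ (D ∪ Φ '' closedBall 0 1) := by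
  have hy : Φ v₀ ∉ D := fun h => disjoint_left.1 hdis ⟨v₀, hv₀, rfl⟩ h
  have hΦ : ContinuousAt Φ v₀ :=
    hc.continuousAt (mem_of_superset (isOpen_ball.mem_nhds hv₀) ball_subset_closedBall)
  obtain ⟨ε, hε, hεU⟩ := Metric.mem_nhds_iff.1 (inter_mem (hΦ hU) (isOpen_ball.mem_nhds hv₀))
  have hV : ∀ᶠ z in 𝓝 (Φ v₀), z ∉ D ∧ ∀ v ∈ closedBall (0 : E) 1, Φ v = z → v ∈ ball v₀ ε := by
    refine Filter.Eventually.and (hD.isOpen_compl.mem_nhds hy)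
      (eventually_of_isCompact (isCompact_closedBall _ _) hc fun v hv hvy => ?_)
    have hvb := mem_ball_of_map_notMem hfr hv (hvy ▸ hy)
    have : v = v₀ := Φ.injOn (hs ▸ hvb) (hs ▸ hv₀) hvy
    exact mem_nhdsWithin_of_mem_nhds (this ▸ ball_mem_nhds _ hε)
  have key : ∀ z ∈ {z | z ∉ D ∧ ∀ v ∈ closedBall (0 : E) 1, Φ v = z → v ∈ ball v₀ ε} ∩
      (D ∪ Φ '' closedBall 0 1), z ∈ Φ.target ∧ Φ.symm z ∈ ball v₀ ε := by
    rintro z ⟨⟨hzD, hz⟩, hz' | ⟨v, hv, rfl⟩⟩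
    · exact absurd hz' hzD
    · have hvb : v ∈ Φ.source := hs ▸ mem_ball_of_map_notMem hfr hv hzD
      exact ⟨Φ.map_source hvb, by rw [Φ.left_inv hvb]; exact hz v hv rfl⟩
  have hconv : ∀ v ∈ ball v₀ ε, ∀ t ∈ Icc (0 : ℝ) 1, (1 - t) • v + t • v₀ ∈ ball v₀ ε :=
    fun v hv t ht => convex_ball v₀ ε hv (mem_ball_self hε) (by linarith [ht.2]) ht.1 (by ring)
  refine ⟨_, hV, fun q => Φ ((1 - q.1) • Φ.symm q.2 + q.1 • v₀), Φ v₀, ?_, ?_⟩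
  · refine hc.comp (t := closedBall 0 1) ?_ ?_
    · have h1 : ContinuousOn (fun q : ℝ × X => Φ.symm q.2) (Icc 0 1 ×ˢ
          ({z | z ∉ D ∧ ∀ v ∈ closedBall (0 : E) 1, Φ v = z → v ∈ ball v₀ ε} ∩
            (D ∪ Φ '' closedBall 0 1))) :=
        hc'.comp continuousOn_snd fun q hq => (key q.2 hq.2).1
      fun_prop
    · rintro ⟨t, z⟩ ⟨ht, hz⟩
      exact ball_subset_closedBall (hεU (hconv _ (key z hz).2 t ht)).2
  · intro z hz
    refine ⟨by simp [Φ.right_inv (key z hz).1], by simp, fun t ht => ?_⟩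
    have := hεU (hconv _ (key z hz).2 t ht)
    exact ⟨this.1, Or.inr ⟨_, ball_subset_closedBall this.2, rfl⟩⟩

/-- Pushes the point `v ≠ 0` of the closed unit ball radially to the unit sphere. -/
def radialPush (t : ℝ) (v : E) : E := (1 - t + t * ‖v‖⁻¹) • v

theorem continuousAt_radialPush {t : ℝ} {v : E} (hv : v ≠ 0) :
    ContinuousAt (fun q : ℝ × E => radialPush q.1 q.2) (t, v) := by
  have : ‖((t, v) : ℝ × E).2‖ ≠ 0 := norm_ne_zero_iff.2 hv
  unfold radialPush
  fun_prop (disch := assumption)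

theorem radialPush_mem_closedBall {t : ℝ} (ht : t ∈ Icc (0 : ℝ) 1) {v : E}
    (hv : v ∈ closedBall (0 : E) 1) : radialPush t v ∈ closedBall (0 : E) 1 := by
  rw [mem_closedBall_zero_iff] at hv ⊢
  obtain ⟨h0, h1⟩ := ht
  rcases eq_or_ne v 0 with rfl | h
  · simp [radialPush]
  have h2 : 0 < ‖v‖ := norm_pos_iff.2 h
  have h3 : 0 ≤ 1 - t + t * ‖v‖⁻¹ := by
    have : 0 ≤ 1 - t := by linarith
    positivity
  rw [radialPush, norm_smul, Real.norm_of_nonneg h3, add_mul, mul_assoc, inv_mul_cancel₀ h2.ne']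
  nlinarith

theorem radialPush_of_mem_sphere {t : ℝ} {v : E} (hv : v ∈ sphere (0 : E) 1) :
    radialPush t v = v := by
  rw [mem_sphere_zero_iff_norm] at hv
  simp [radialPush, hv]

theorem radialPush_zero (v : E) : radialPush 0 v = v := by simp [radialPush]

theorem radialPush_one_mem_sphere {v : E} (hv : v ≠ 0) : radialPush 1 v ∈ sphere (0 : E) 1 := by
  simp [radialPush, norm_smul, norm_ne_zero_iff.2 hv]

/-- Attaching a cell preserves local contractibility: near a point of `D`, first push the new cell
radially into `D`, then contract inside `D`. -/
theorem IsLocallyContractible.attach [ProperSpace E] (hLC : IsLocallyContractible D)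
    (hD : IsClosed D) (hs : Φ.source = ball 0 1) (hc : ContinuousOn Φ (closedBall 0 1))
    (hc' : ContinuousOn Φ.symm Φ.target) (hfr : MapsTo Φ (sphere 0 1) D)
    (hdis : Disjoint (Φ '' ball 0 1) D) :
    IsLocallyContractible (D ∪ Φ '' closedBall 0 1) := by
  classical
  intro y hy U hU
  by_cases hyD : y ∉ D
  · obtain ⟨v₀, hv₀, rfl⟩ := hy.resolve_left hyD
    exact exists_contraction_of_mem_openCell hD hs hc hc' hfr hdis
      (mem_ball_of_map_notMem hfr hv₀ hyD) hU
  rw [not_not] at hyD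
  obtain ⟨V₀, hV₀, H₀, w, hH₀, hH₀'⟩ := hLC y hyD U hU
  -- the retraction of a neighbourhood of `y` to `D`
  let R : ℝ × X → X := fun q => if q.2 ∈ D then q.2 else Φ (radialPush q.1 (Φ.symm q.2))
  have hRD : ∀ t, ∀ z ∈ D, R (t, z) = z := fun t z hz => if_pos hz
  have hRΦ : ∀ t, ∀ v ∈ closedBall (0 : E) 1, R (t, Φ v) = Φ (radialPush t v) := by
    intro t v hv
    by_cases h : Φ v ∈ D
    · rw [hRD t _ h, radialPush_of_mem_sphere (mem_sphere_of_map_mem hdis hv h)]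
    · have : v ∈ Φ.source := hs ▸ mem_ball_of_map_notMem hfr hv h
      simp only [R, if_neg h, Φ.left_inv this]
  let T : Set E := {v | v ≠ 0 ∧ Φ (radialPush 1 v) ∈ V₀ ∧
    ∀ t ∈ Icc (0 : ℝ) 1, Φ (radialPush t v) ∈ U}
  have hTnhds : ∀ v ∈ closedBall (0 : E) 1, Φ v = y → T ∈ 𝓝[closedBall 0 1] v := by
    rintro v hv rfl
    have hvs := mem_sphere_of_map_mem hdis hv hyD
    have hv0 : v ≠ 0 := ne_of_mem_sphere hvs one_ne_zero
    have hcont : ∀ t ∈ Icc (0 : ℝ) 1, ∀ W ∈ 𝓝 (Φ v), ∀ᶠ q : E × ℝ in 𝓝 (v, t),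
        q.1 ∈ closedBall (0 : E) 1 → q.2 ∈ Icc (0 : ℝ) 1 → Φ (radialPush q.2 q.1) ∈ W := by
      intro t ht W hW
      have h1 : ContinuousAt (fun q : E × ℝ => radialPush q.2 q.1) (v, t) :=
        (continuousAt_radialPush (t := t) hv0).comp (x := (v, t)) (f := Prod.swap)
          continuous_swap.continuousAt
      have h2 := hc v hv
      rw [ContinuousWithinAt, tendsto_def] at h2
      have h3 := mem_nhdsWithin_iff_eventually.1 (h2 W hW)
      rw [← radialPush_of_mem_sphere (t := t) hvs] at h3
      filter_upwards [h1.eventually h3] with q hq hq1 hq2 using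
        hq (radialPush_mem_closedBall hq2 hq1)
    rw [mem_nhdsWithin_iff_eventually]
    have e1 : ∀ᶠ v' in 𝓝 v, v' ≠ 0 := isOpen_ne.mem_nhds hv0
    have e2 : ∀ᶠ v' in 𝓝 v, v' ∈ closedBall (0 : E) 1 → Φ (radialPush 1 v') ∈ V₀ := by
      have h1 : ∀ᶠ v' in 𝓝 v, (v', (1 : ℝ)) ∈ {q : E × ℝ | q.1 ∈ closedBall (0 : E) 1 →
          q.2 ∈ Icc (0 : ℝ) 1 → Φ (radialPush q.2 q.1) ∈ V₀} :=
        (show ContinuousAt (fun v' : E => (v', (1 : ℝ))) v by fun_prop) (hcont 1 (by simp) V₀ hV₀)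
      filter_upwards [h1] with v' hv' hv'' using hv' hv'' (by simp)
    have e3 : ∀ᶠ v' in 𝓝 v, ∀ t ∈ Icc (0 : ℝ) 1, v' ∈ closedBall (0 : E) 1 → t ∈ Icc (0 : ℝ) 1 →
        Φ (radialPush t v') ∈ U :=
      isCompact_Icc.eventually_forall_of_forall_eventually fun t ht => hcont t ht U hU
    filter_upwards [e1, e2, e3] with v' h1 h2 h3 h4 using ⟨h1, h2 h4, fun t ht => h3 t ht h4 ht⟩
  have hV : ∀ᶠ z in 𝓝 y, z ∈ V₀ ∧ ∀ v ∈ closedBall (0 : E) 1, Φ v = z → v ∈ T :=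
    Filter.Eventually.and hV₀ (eventually_of_isCompact (isCompact_closedBall _ _) hc hTnhds)
  set V : Set X := {z | z ∈ V₀ ∧ ∀ v ∈ closedBall (0 : E) 1, Φ v = z → v ∈ T} with hVdef
  have hR0 : ∀ z ∈ V ∩ (D ∪ Φ '' closedBall 0 1), R (0, z) = z := by
    rintro z ⟨-, hz | ⟨v, hv, rfl⟩⟩
    · exact hRD _ _ hz
    · rw [hRΦ _ v hv, radialPush_zero]
  have hR1 : ∀ z ∈ V ∩ (D ∪ Φ '' closedBall 0 1), R (1, z) ∈ V₀ ∩ D := by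
    rintro z ⟨hzV, hz | ⟨v, hv, rfl⟩⟩
    · rw [hRD _ _ hz]; exact ⟨hzV.1, hz⟩
    · rw [hRΦ _ v hv]
      have := hzV.2 v hv rfl
      exact ⟨this.2.1, hfr (radialPush_one_mem_sphere this.1)⟩
  have hV₀U : ∀ z ∈ V₀ ∩ D, z ∈ U := fun z hz => by
    have := (hH₀' z hz).2.2 0 (by simp)
    rw [(hH₀' z hz).1] at this
    exact this.1
  have hRt : ∀ z ∈ V ∩ (D ∪ Φ '' closedBall 0 1), ∀ t ∈ Icc (0 : ℝ) 1,
      R (t, z) ∈ U ∩ (D ∪ Φ '' closedBall 0 1) := by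
    rintro z ⟨hzV, hz | ⟨v, hv, rfl⟩⟩ t ht
    · rw [hRD _ _ hz]; exact ⟨hV₀U _ ⟨hzV.1, hz⟩, Or.inl hz⟩
    · rw [hRΦ _ v hv]
      exact ⟨(hzV.2 v hv rfl).2.2 t ht, Or.inr ⟨_, radialPush_mem_closedBall ht hv, rfl⟩⟩
  have hRcont : ContinuousOn R (Icc 0 1 ×ˢ (V ∩ (D ∪ Φ '' closedBall 0 1))) := by
    have hsplit : (Icc (0 : ℝ) 1) ×ˢ (V ∩ (D ∪ Φ '' closedBall 0 1)) =
        (Icc (0 : ℝ) 1) ×ˢ (V ∩ D) ∪ (Icc (0 : ℝ) 1) ×ˢ (V ∩ Φ '' closedBall 0 1) := by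
      rw [inter_union_distrib_left, prod_union]
    rintro ⟨t, z⟩ ⟨ht, hz⟩
    rw [hsplit]
    refine ContinuousWithinAt.union ?_ ?_
    · by_cases hzD : z ∈ D
      · exact continuousWithinAt_snd.congr (fun q hq => hRD q.1 q.2 hq.2.2) (hRD t z hzD)
      · refine continuousWithinAt_of_notMem_closure fun h => hzD ?_
        have h1 : closure ((Icc (0 : ℝ) 1) ×ˢ (V ∩ D)) ⊆ Prod.snd ⁻¹' D :=
          closure_minimal (fun q hq => hq.2.2) (hD.preimage continuous_snd)
        exact h1 h
    · refine continuousWithinAt_of_isCompact (K := Icc (0 : ℝ) 1 ×ˢ closedBall (0 : E) 1)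
        (g := fun q => (q.1, Φ q.2)) (isCompact_Icc.prod (isCompact_closedBall _ _)) ?_ ?_ ?_
      · exact continuousOn_fst.prodMk (hc.comp continuousOn_snd fun q hq => hq.2)
      · rintro ⟨t', z'⟩ ⟨ht', hz', v, hv, rfl⟩
        exact ⟨(t', v), ⟨ht', hv⟩, rfl⟩
      · rintro ⟨t', v⟩ ⟨ht', hv⟩ heq
        simp only [Prod.mk.injEq] at heq
        obtain ⟨rfl, rfl⟩ := heq
        have hv0 : v ≠ 0 := (hz.1.2 v hv rfl).1
        have h1 : ContinuousWithinAt (fun q : ℝ × E => Φ (radialPush q.1 q.2))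
            (Icc (0 : ℝ) 1 ×ˢ closedBall (0 : E) 1) (t', v) :=
          ContinuousWithinAt.comp (t := closedBall 0 1) (hc _ (radialPush_mem_closedBall ht' hv))
            (continuousAt_radialPush hv0).continuousWithinAt
            fun q hq => radialPush_mem_closedBall hq.1 hq.2
        exact (h1.mono inter_subset_left).congr (fun q hq => hRΦ q.1 q.2 hq.1.2) (hRΦ _ _ hv)
  refine ⟨V, hV, fun q => if q.1 ≤ 1 / 2 then R (2 * q.1, q.2) else
    H₀ (2 * q.1 - 1, R (1, q.2)), w, ?_, ?_⟩
  · have hcl : closure {q : ℝ × X | q.1 ≤ 1 / 2} = {q | q.1 ≤ 1 / 2} :=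
      (isClosed_le continuous_fst continuous_const).closure_eq
    have hcl' : closure {q : ℝ × X | ¬ q.1 ≤ 1 / 2} ⊆ {q | 1 / 2 ≤ q.1} :=
      closure_minimal (fun q hq => (not_le.1 hq).le) (isClosed_le continuous_const continuous_fst)
    refine ContinuousOn.if ?_ ?_ ?_
    · rintro ⟨t, z⟩ ⟨hq, hf⟩
      have ht : t = 1 / 2 := frontier_le_subset_eq continuous_fst continuous_const hf
      subst ht
      norm_num
      exact ((hH₀' _ (hR1 z hq.2)).1).symm
    · rw [hcl]
      refine hRcont.comp (f := fun q : ℝ × X => (2 * q.1, q.2)) (by fun_prop) ?_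
      rintro ⟨t, z⟩ ⟨⟨ht, hz⟩, ht'⟩
      rw [mem_ofPred_eq] at ht'
      exact ⟨⟨by linarith [ht.1], by linarith⟩, hz⟩
    · have h1 : ContinuousOn (fun q : ℝ × X => R (1, q.2))
          (Icc 0 1 ×ˢ (V ∩ (D ∪ Φ '' closedBall 0 1))) :=
        hRcont.comp (f := fun q : ℝ × X => ((1 : ℝ), q.2)) (by fun_prop)
          fun q hq => ⟨by simp, hq.2⟩
      refine hH₀.comp (f := fun q : ℝ × X => (2 * q.1 - 1, R (1, q.2))) ?_ ?_
      · exact ContinuousOn.prodMk (by fun_prop) (h1.mono inter_subset_left)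
      · rintro ⟨t, z⟩ ⟨⟨ht, hz⟩, ht'⟩
        have ht'' : 1 / 2 ≤ t := hcl' ht'
        exact ⟨⟨by linarith, by linarith [ht.2]⟩, hR1 z hz⟩
  · intro z hz
    refine ⟨?_, ?_, fun t ht => ?_⟩
    · simp [hR0 z hz]
    · norm_num
      exact (hH₀' _ (hR1 z hz)).2.1
    · dsimp only
      split_ifs with h
      · exact hRt z hz _ ⟨by linarith [ht.1], by linarith⟩
      · have := (hH₀' _ (hR1 z hz)).2.2 (2 * t - 1) ⟨by linarith, by linarith [ht.2]⟩
        exact ⟨this.1, Or.inl this.2⟩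

end AttachCell

open Topology.RelCWComplex in
/-- The cells are attached one at a time, in the order of their dimensions. -/
theorem isLocallyContractible_of_finite {X : Type*} [TopologicalSpace X] [T2Space X] (C : Set X)
    [Topology.CWComplex C] [Topology.CWComplex.Finite C] : IsLocallyContractible C := by
  classical
  have hskel : ∀ n : ℕ, IsLocallyContractible (skeletonLT C n : Set X) := by
    intro n
    induction n with
    | zero =>
      intro y hy
      simp [Topology.CWComplex.skeletonLT_zero_eq_empty] at hy
    | succ n ih =>
      have hfin : Finite (cell C n) := Topology.RelCWComplex.FiniteType.finite_cell n
      have hstep : ∀ s : Finset (cell C n),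
          IsLocallyContractible ((skeletonLT C n : Set X) ∪ ⋃ j ∈ s, closedCell n j) := by
        intro s
        induction s using Finset.induction_on with
        | empty => simpa using ih
        | insert i s hi ihs =>
          have h1 := ihs.attach (Φ := map n i) ?_ (source_eq n i) (continuousOn n i)
            (continuousOn_symm n i) ?_ ?_
          · rw [Finset.set_biUnion_insert, union_comm (closedCell n i), ← union_assoc]
            exact h1
          · exact (skeletonLT C n).closed.union
              (s.finite_toSet.isClosed_biUnion fun j _ => isClosed_closedCell)
          · intro v hv
            exact Or.inl (cellFrontier_subset_skeletonLT n i ⟨v, hv, rfl⟩)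
          · change Disjoint (openCell n i) _
            have h2 : Disjoint (openCell n i) (skeletonLT C n : Set X) :=
              (disjoint_skeletonLT_openCell le_rfl).symm
            rw [disjoint_union_right, disjoint_iUnion₂_right]
            refine ⟨h2, fun j hj => ?_⟩
            rw [← cellFrontier_union_openCell_eq_closedCell, disjoint_union_right]
            refine ⟨h2.mono_right (cellFrontier_subset_skeletonLT n j),
              disjoint_openCell_of_ne fun h => hi ?_⟩
            have hij : i = j := by simpa using h
            exact hij ▸ hj
      have := hstep (@Finset.univ _ (Fintype.ofFinite _))
      have h3 := skeletonLT_union_iUnion_closedCell_eq_skeletonLT_succ (C := C) n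
      simp only [Finset.mem_univ, iUnion_true] at this
      rw [h3] at this
      exact_mod_cast this
  obtain ⟨n, hn⟩ := eventually_atTop.1
    (Topology.RelCWComplex.FiniteDimensional.eventually_isEmpty_cell (C := C) (D := ∅))
  have : (skeletonLT C n : Set X) = C := by
    refine subset_antisymm (skeletonLT C n).subset_complex ?_
    intro x hx
    rw [← Topology.CWComplex.iUnion_openCell_eq_complex (C := C)] at hx
    simp only [mem_iUnion] at hx
    obtain ⟨m, j, hxj⟩ := hx
    have hmn : m < n := by
      by_contra h
      exact (hn m (not_lt.1 h)).false j
    exact Topology.CWComplex.mem_skeletonLT_iff.2 ⟨m, by exact_mod_cast hmn, j, hxj⟩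
  rw [← this]
  exact hskel n

end LargeGroups

end

/-! ### Cocycles on paths -/

noncomputable section

open Set Filter Topology Metric

namespace LargeGroups

open scoped unitInterval

variable {X : Type*} [TopologicalSpace X] {G : Type*} [Group G]

/-- The path `t ↦ f ((1 - t) u + t v)`, that is, the restriction of `f` to the segment from `u` to
`v`. -/
def segmentPath (f : C(ℝ × ℝ, X)) (u v : ℝ × ℝ) : C(I, X) :=
  f.comp ⟨fun t => AffineMap.lineMap u v (t : ℝ), by fun_prop⟩

theorem segmentPath_apply (f : C(ℝ × ℝ, X)) (u v : ℝ × ℝ) (t : I) :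
    segmentPath f u v t = f (AffineMap.lineMap u v (t : ℝ)) := rfl

@[simp] theorem segmentPath_zero (f : C(ℝ × ℝ, X)) (u v : ℝ × ℝ) :
    segmentPath f u v 0 = f u := by simp [segmentPath_apply]

@[simp] theorem segmentPath_one (f : C(ℝ × ℝ, X)) (u v : ℝ × ℝ) :
    segmentPath f u v 1 = f v := by simp [segmentPath_apply]

/-- A function `c` on paths is a (non-abelian, singular) `1`-cocycle on `A` if
`c(01) c(12) = c(02)` for the edges of each triangle in `A`. Triangles are given by maps of the
whole plane and three points in it, which costs no generality and avoids coordinates on a simplex.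
The values of `c` on paths that leave `A` are irrelevant. -/
def IsPathCocycle (A : Set X) (c : C(I, X) → G) : Prop :=
  ∀ f : C(ℝ × ℝ, X), (∀ q, f q ∈ A) → ∀ u v w : ℝ × ℝ,
    c (segmentPath f u v) * c (segmentPath f v w) = c (segmentPath f u w)

/-- A path, extended to the plane as a function of the first coordinate. -/
def extendPath (γ : C(I, X)) : C(ℝ × ℝ, X) :=
  γ.comp ⟨fun q => projIcc 0 1 zero_le_one q.1, by fun_prop⟩

theorem segmentPath_extendPath (γ : C(I, X)) (a b : ℝ) :
    segmentPath (extendPath γ) (0, a) (1, b) = γ := by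
  ext t
  have : (AffineMap.lineMap ((0 : ℝ), a) ((1 : ℝ), b) (t : ℝ)).1 = t := by
    simp [AffineMap.lineMap_apply]
  simp only [segmentPath_apply, extendPath, ContinuousMap.comp_apply, ContinuousMap.coe_mk, this]
  rw [projIcc_val]

theorem extendPath_mem {A : Set X} {γ : C(I, X)} (h : ∀ t, γ t ∈ A) (q : ℝ × ℝ) :
    extendPath γ q ∈ A := h _

theorem segmentPath_extendPath_trans_left {x y z : X} (γ : Path x y) (γ' : Path y z) :
    segmentPath (extendPath (γ.trans γ' : C(I, X))) (0, 0) (1 / 2, 0) = γ := by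
  ext t
  have ht := t.2
  have h2 : (AffineMap.lineMap ((0 : ℝ), (0 : ℝ)) ((1 / 2 : ℝ), (0 : ℝ)) (t : ℝ)).1 = t / 2 := by
    simp [AffineMap.lineMap_apply]; ring
  simp only [segmentPath_apply, extendPath, ContinuousMap.comp_apply, ContinuousMap.coe_mk, h2]
  rw [projIcc_of_mem (h := zero_le_one) (hx := ⟨by linarith [ht.1], by linarith [ht.2]⟩)]
  refine (Path.trans_apply _ _ _).trans ?_
  rw [dif_pos (by dsimp only; linarith [ht.2])]
  exact congrArg γ (Subtype.ext (by dsimp only; ring))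

theorem segmentPath_extendPath_trans_right {x y z : X} (γ : Path x y) (γ' : Path y z) :
    segmentPath (extendPath (γ.trans γ' : C(I, X))) (1 / 2, 0) (1, 0) = γ' := by
  ext t
  have ht := t.2
  have h2 : (AffineMap.lineMap ((1 / 2 : ℝ), (0 : ℝ)) ((1 : ℝ), (0 : ℝ)) (t : ℝ)).1 =
      (1 + t) / 2 := by
    simp [AffineMap.lineMap_apply]; ring
  simp only [segmentPath_apply, extendPath, ContinuousMap.comp_apply, ContinuousMap.coe_mk, h2]
  rw [projIcc_of_mem (h := zero_le_one) (hx := ⟨by linarith [ht.1], by linarith [ht.2]⟩)]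
  refine (Path.trans_apply _ _ _).trans ?_
  split_ifs with h3
  · dsimp only at h3
    have h4 : t = 0 := Subtype.ext (by change (t : ℝ) = 0; linarith [ht.1])
    subst h4
    have h5 : γ ⟨2 * ((1 + ((0 : I) : ℝ)) / 2), by norm_num⟩ = γ 1 :=
      congrArg γ (Subtype.ext (by simp))
    refine h5.trans ?_
    simp
  · exact congrArg γ' (Subtype.ext (by dsimp only; ring))

namespace IsPathCocycle

variable {A : Set X} {c : C(I, X) → G}

theorem map_segmentPath_self (hc : IsPathCocycle A c) {f : C(ℝ × ℝ, X)} (hf : ∀ q, f q ∈ A)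
    (u : ℝ × ℝ) : c (segmentPath f u u) = 1 := by
  simpa using hc f hf u u u

theorem map_const (hc : IsPathCocycle A c) {x : X} (hx : x ∈ A) :
    c (ContinuousMap.const I x) = 1 := by
  have := hc.map_segmentPath_self (f := ContinuousMap.const _ x) (fun _ => hx) 0
  exact this

/-- The two ways around a square have the same value. -/
theorem map_square (hc : IsPathCocycle A c) {f : C(ℝ × ℝ, X)} (hf : ∀ q, f q ∈ A)
    (u v v' w : ℝ × ℝ) :
    c (segmentPath f u v) * c (segmentPath f v w) =
      c (segmentPath f u v') * c (segmentPath f v' w) := by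
  rw [hc f hf, hc f hf]

theorem map_trans (hc : IsPathCocycle A c) {x y z : X} (γ : Path x y) (γ' : Path y z)
    (h : ∀ t, γ t ∈ A) (h' : ∀ t, γ' t ∈ A) :
    c (γ.trans γ') = c γ * c γ' := by
  have hA : ∀ t, (γ.trans γ' : C(I, X)) t ∈ A := by
    intro t
    change γ.trans γ' t ∈ A
    have : γ.trans γ' t ∈ range (γ.trans γ') := ⟨t, rfl⟩
    rw [Path.trans_range] at this
    rcases this with ⟨s, hs⟩ | ⟨s, hs⟩
    · exact hs ▸ h s
    · exact hs ▸ h' s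
  have h1 := hc _ (extendPath_mem hA) (0, 0) (1 / 2, 0) (1, 0)
  rw [segmentPath_extendPath] at h1
  rw [← h1]
  rw [segmentPath_extendPath_trans_left, segmentPath_extendPath_trans_right]

theorem map_refl (hc : IsPathCocycle A c) {x : X} (hx : x ∈ A) : c (Path.refl x) = 1 :=
  hc.map_const hx

theorem map_symm (hc : IsPathCocycle A c) {x y : X} (γ : Path x y) (h : ∀ t, γ t ∈ A) :
    c γ.symm = (c γ)⁻¹ := by
  have h1 := hc (extendPath (γ : C(I, X))) (extendPath_mem h) (0, 0) (1, 0) (0, 0)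
  have h3 := hc.map_segmentPath_self (f := extendPath (γ : C(I, X))) (extendPath_mem h) (0, 0)
  rw [segmentPath_extendPath, h3] at h1
  refine Eq.trans ?_ (mul_eq_one_iff_inv_eq.1 h1).symm
  congr 1
  ext t
  have h2 : (AffineMap.lineMap ((1 : ℝ), (0 : ℝ)) ((0 : ℝ), (0 : ℝ)) (t : ℝ)).1 = 1 - t := by
    simp [AffineMap.lineMap_apply]; ring
  simp only [segmentPath_apply, extendPath, ContinuousMap.comp_apply, ContinuousMap.coe_mk, h2]
  rw [projIcc_of_mem (h := zero_le_one) (hx := ⟨by linarith [t.2.2], by linarith [t.2.1]⟩)]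
  rfl

/-- On a locally contractible set a cocycle is locally a coboundary. -/
theorem exists_potential (hA : IsLocallyContractible A) (hc : IsPathCocycle A c) {y : X}
    (hy : y ∈ A) : ∃ V ∈ 𝓝 y, ∃ φ : X → G, φ y = 1 ∧
      ∀ γ : C(I, X), (∀ t, γ t ∈ V ∩ A) → c γ = (φ (γ 0))⁻¹ * φ (γ 1) := by
  classical
  obtain ⟨V, hV, H, w, hH, hH'⟩ := hA y hy univ univ_mem
  -- the homotopy, applied to a path
  let F : ∀ γ : C(I, X), (∀ t, γ t ∈ V ∩ A) → C(ℝ × ℝ, X) := fun γ hγ =>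
    ⟨fun q => H (projIcc (0 : ℝ) 1 zero_le_one q.1, γ (projIcc 0 1 zero_le_one q.2)),
      hH.comp_continuous (by fun_prop) fun q => ⟨Subtype.coe_prop _, hγ _⟩⟩
  have hFA : ∀ γ hγ q, F γ hγ q ∈ A := fun γ hγ q => ((hH' _ (hγ _)).2.2 _ (Subtype.coe_prop _)).2
  let τ : X → G := fun z => if h : z ∈ V ∩ A then
    c (segmentPath (F (ContinuousMap.const I z) fun _ => h) (0, 0) (1, 0)) else 1
  have hτ : ∀ γ hγ (b : I), c (segmentPath (F γ hγ) (0, (b : ℝ)) (1, (b : ℝ))) = τ (γ b) := by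
    intro γ hγ b
    simp only [τ, dif_pos (hγ b)]
    congr 1
    ext t
    simp [segmentPath_apply, F, AffineMap.lineMap_apply]
  have hw : ∀ γ hγ, c (segmentPath (F γ hγ) (1, 0) (1, 1)) = 1 := by
    intro γ hγ
    have hwA : w ∈ A := by
      have := (hH' _ (hγ 0)).2.2 1 (by simp)
      rw [(hH' _ (hγ 0)).2.1] at this
      exact this.2
    rw [← hc.map_const hwA]
    congr 1
    ext t
    simp [segmentPath_apply, F, AffineMap.lineMap_apply, (hH' _ (hγ _)).2.1]
  refine ⟨V, hV, fun z => τ y * (τ z)⁻¹, by simp, fun γ hγ => ?_⟩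
  have h1 := hc.map_square (hFA γ hγ) (0, 0) (0, 1) (1, 0) (1, 1)
  have h2 : segmentPath (F γ hγ) (0, 0) (0, 1) = γ := by
    ext t
    simp [segmentPath_apply, F, AffineMap.lineMap_apply, (hH' _ (hγ _)).1]
  have h3 := hτ γ hγ 0
  have h4 := hτ γ hγ 1
  rw [Icc.coe_zero] at h3
  rw [Icc.coe_one] at h4
  rw [h2, hw γ hγ, h3, h4, mul_one] at h1
  rw [mul_inv_rev, inv_inv, mul_assoc, inv_mul_cancel_left, ← h1, mul_assoc, mul_inv_cancel,
    mul_one]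

end IsPathCocycle

theorem IsLocallyContractible.eventually_joinedIn {A : Set X} (hA : IsLocallyContractible A) {y : X}
    (hy : y ∈ A) {U : Set X} (hU : U ∈ 𝓝 y) : ∀ᶠ z in 𝓝 y, z ∈ A → JoinedIn (U ∩ A) y z := by
  obtain ⟨V, hV, H, w, hH, hH'⟩ := hA y hy U hU
  have key : ∀ z ∈ V ∩ A, JoinedIn (U ∩ A) z w := fun z hz =>
    ⟨⟨⟨fun t => H (t, z), hH.comp_continuous (by fun_prop) fun t => ⟨t.2, hz⟩⟩,
      (hH' z hz).1, (hH' z hz).2.1⟩, fun t => (hH' z hz).2.2 t t.2⟩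
  filter_upwards [hV] with z hz hzA using
    (key y ⟨mem_of_mem_nhds hV, hy⟩).trans (key z ⟨hz, hzA⟩).symm

end LargeGroups

end

/-! ### Gluing cocycles on closed sets -/

noncomputable section

open Set Filter Topology Metric

namespace LargeGroups

open scoped unitInterval

variable {X : Type*} [TopologicalSpace X] {G : Type*} [Group G]

/-- Data describing a `G`-covering of `X`: a function `φ y` on a neighbourhood `N y` of each point
`y` such that on overlaps `φ y` and `φ y'` differ by a locally constant factor on the left. The
path from `y'` to a nearby point `z` is given the label `(φ y y')⁻¹ * φ y z`, for each `y` with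
`y' ∈ N y`. -/
structure IsLocalPotential (N : X → Set X) (φ : X → X → G) : Prop where
  isOpen : ∀ y, IsOpen (N y)
  mem : ∀ y, y ∈ N y
  self : ∀ y, φ y y = 1
  eventually_eq : ∀ y, ∀ y' ∈ N y, ∀ᶠ z in 𝓝 y', φ y' z = (φ y y')⁻¹ * φ y z

/-- The local primitives of the cocycles on the members of a closed cover agree on their
intersections near each point, by path connectedness, and fit together to a local potential. -/
theorem exists_isLocalPotential {ι : Type*} [Finite ι] {A : ι → Set X} {c : ι → C(I, X) → G}
    (hclosed : ∀ i, IsClosed (A i)) (hcover : ∀ x, ∃ i, x ∈ A i)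
    (hLC : ∀ i j, IsLocallyContractible (A i ∩ A j)) (hc : ∀ i, IsPathCocycle (A i) (c i))
    (hcompat : ∀ i j, ∀ γ : C(I, X), (∀ t, γ t ∈ A i ∩ A j) → c i γ = c j γ) :
    ∃ (N : X → Set X) (φ : X → X → G), IsLocalPotential N φ ∧
      ∀ y i, ∀ γ : C(I, X), (∀ t, γ t ∈ N y ∩ A i) → c i γ = (φ y (γ 0))⁻¹ * φ y (γ 1) := by
  have hLC' : ∀ i, IsLocallyContractible (A i) := fun i => by simpa using hLC i i
  have h1 : ∀ y i, ∃ V ∈ 𝓝 y, ∃ φ : X → G, φ y = 1 ∧ (y ∉ A i → V ∩ A i = ∅) ∧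
      ∀ γ : C(I, X), (∀ t, γ t ∈ V ∩ A i) → c i γ = (φ (γ 0))⁻¹ * φ (γ 1) := by
    intro y i
    by_cases hy : y ∈ A i
    · obtain ⟨V, hV, φ, hφ, hφ'⟩ := (hc i).exists_potential (hLC' i) hy
      exact ⟨V, hV, φ, hφ, fun h => absurd hy h, hφ'⟩
    · exact ⟨(A i)ᶜ, (hclosed i).isOpen_compl.mem_nhds hy, fun _ => 1, rfl,
        fun _ => compl_inter_self _, fun γ hγ => absurd (hγ 0).2 (hγ 0).1⟩
  choose V hV ψ hψ hVA hψc using h1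
  have h2 : ∀ y, ∀ᶠ z in 𝓝 y, ∀ i j, y ∈ A i ∩ A j → z ∈ A i ∩ A j → ψ y i z = ψ y j z := by
    intro y
    simp only [eventually_all]
    intro i j hy
    filter_upwards [(hLC i j).eventually_joinedIn hy (inter_mem (hV y i) (hV y j))] with z hz hzA
    obtain ⟨γ, hγ⟩ := hz hzA
    have e1 := hψc y i γ fun t => ⟨(hγ t).1.1, (hγ t).2.1⟩
    have e2 := hψc y j γ fun t => ⟨(hγ t).1.2, (hγ t).2.2⟩
    rw [hcompat i j γ fun t => (hγ t).2, e2] at e1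
    simpa [hψ] using e1.symm
  choose idx hidx using hcover
  let N₀ : X → Set X := fun y => {z | (∀ i, z ∈ V y i) ∧
    ∀ i j, y ∈ A i ∩ A j → z ∈ A i ∩ A j → ψ y i z = ψ y j z}
  have hN₀ : ∀ y, N₀ y ∈ 𝓝 y := fun y => by
    have : ∀ᶠ z in 𝓝 y, ∀ i, z ∈ V y i := eventually_all.2 fun i => hV y i
    exact this.and (h2 y)
  -- a member of the cover that meets `N₀ y` contains `y`
  have hmem : ∀ y z i, z ∈ N₀ y → z ∈ A i → y ∈ A i := by
    intro y z i hz hzi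
    by_contra hy
    exact notMem_empty z (hVA y i hy ▸ ⟨hz.1 i, hzi⟩)
  let φ : X → X → G := fun y z => ψ y (idx z) z
  have hφ : ∀ y z i, z ∈ N₀ y → z ∈ A i → φ y z = ψ y i z := fun y z i hz hzi =>
    hz.2 _ _ ⟨hmem y z _ hz (hidx z), hmem y z i hz hzi⟩ ⟨hidx z, hzi⟩
  have hφc : ∀ y i, ∀ γ : C(I, X), (∀ t, γ t ∈ N₀ y ∩ A i) →
      c i γ = (φ y (γ 0))⁻¹ * φ y (γ 1) := by
    intro y i γ hγ
    rw [hφ y _ i (hγ 0).1 (hγ 0).2, hφ y _ i (hγ 1).1 (hγ 1).2]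
    exact hψc y i γ fun t => ⟨(hγ t).1.1 i, (hγ t).2⟩
  refine ⟨fun y => interior (N₀ y), φ, ⟨fun y => isOpen_interior,
    fun y => mem_interior_iff_mem_nhds.2 (hN₀ y), fun y => hψ y _, ?_⟩,
    fun y i γ hγ => hφc y i γ fun t => ⟨interior_subset (hγ t).1, (hγ t).2⟩⟩
  intro y y' hy'
  have hy'N : N₀ y ∈ 𝓝 y' := mem_interior_iff_mem_nhds.1 hy'
  have h3 : ∀ᶠ z in 𝓝 y', ∀ i, y' ∈ A i → z ∈ A i → JoinedIn ((N₀ y ∩ N₀ y') ∩ A i) y' z := by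
    simp only [eventually_all]
    exact fun i hi => (hLC' i).eventually_joinedIn hi (inter_mem hy'N (hN₀ y'))
  filter_upwards [h3, hN₀ y'] with z hz hzN
  obtain ⟨γ, hγ⟩ := hz (idx z) (hmem _ _ _ hzN (hidx z)) (hidx z)
  have e1 := hφc y _ γ fun t => ⟨(hγ t).1.1, (hγ t).2⟩
  have e2 := hφc y' _ γ fun t => ⟨(hγ t).1.2, (hγ t).2⟩
  rw [e1] at e2
  simpa [show φ y' y' = 1 from hψ y' _] using e2.symm

namespace IsLocalPotential

variable {N : X → Set X} {φ : X → X → G}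

theorem eventually_transition (h : IsLocalPotential N φ) {y y' x : X} (hy : x ∈ N y)
    (hy' : x ∈ N y') : ∀ᶠ z in 𝓝 x, φ y z * (φ y' z)⁻¹ = φ y x * (φ y' x)⁻¹ := by
  filter_upwards [h.eventually_eq y x hy, h.eventually_eq y' x hy'] with z h1 h2
  rw [h1] at h2
  have : φ y z = φ y x * (φ y' x)⁻¹ * φ y' z := by
    rw [mul_assoc, ← h2, mul_inv_cancel_left]
  rw [this, mul_inv_cancel_right]

/-- The `G`-covering defined by a local potential, as a fibre bundle with discrete fibre. The point
`g` of the fibre has the coordinate `g * (φ y x)⁻¹` in the chart with index `y`. -/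
def core [TopologicalSpace G] [DiscreteTopology G] (h : IsLocalPotential N φ) :
    FiberBundleCore X X G where
  baseSet := N
  isOpen_baseSet := h.isOpen
  indexAt := id
  mem_baseSet_at := h.mem
  coordChange y y' x g := g * (φ y x * (φ y' x)⁻¹)
  coordChange_self y x _ g := by simp
  continuousOn_coordChange y y' := by
    rintro ⟨x, g⟩ ⟨⟨hx, hx'⟩, -⟩
    refine ContinuousAt.continuousWithinAt ?_
    have h1 : ∀ᶠ q : X × G in 𝓝 (x, g), q.2 * (φ y q.1 * (φ y' q.1)⁻¹) =
        g * (φ y x * (φ y' x)⁻¹) := by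
      rw [nhds_prod_eq, nhds_discrete G, Filter.prod_pure]
      exact (h.eventually_transition hx hx').mono fun z hz => congrArg (g * ·) hz
    exact (continuousAt_const (y := g * (φ y x * (φ y' x)⁻¹))).congr
      (h1.mono fun q hq => hq.symm)
  coordChange_comp y y' y'' x _ g := by group

/-- A labelling `g` of the points of the path `γ` that changes as the local potential `φ`
prescribes; equivalently, a lift of `γ` to the covering defined by `φ`. -/
def IsHorizontal (φ : X → X → G) (γ : C(I, X)) (g : I → G) : Prop :=
  ∀ t₀, ∀ᶠ t in 𝓝 t₀, g t = g t₀ * φ (γ t₀) (γ t)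

theorem IsHorizontal.comp {γ : C(I, X)} {g : I → G} (hg : IsHorizontal φ γ g) (θ : C(I, I)) :
    IsHorizontal φ (γ.comp θ) (g ∘ θ) :=
  fun t₀ => θ.continuous.continuousAt.eventually (hg (θ t₀))

theorem IsHorizontal.const_mul {γ : C(I, X)} {g : I → G} (hg : IsHorizontal φ γ g) (a : G) :
    IsHorizontal φ γ (fun t => a * g t) :=
  fun t₀ => (hg t₀).mono fun t ht => by simp only [ht, mul_assoc]

section

variable [TopologicalSpace G] [DiscreteTopology G] (h : IsLocalPotential N φ)

theorem isCoveringMap : IsCoveringMap h.core.proj :=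
  FiberBundle.isCoveringMap (F := G) (E := h.core.Fiber)

/-- The point with label `g` over `x`. -/
def point (x : X) (g : G) : h.core.TotalSpace := ⟨x, g⟩

/-- The label of a point of the covering. -/
def label (e : h.core.TotalSpace) : G := e.2

/-- The lift of `γ` with the labels `g`. -/
def lift (γ : C(I, X)) (g : I → G) (t : I) : h.core.TotalSpace := h.point (γ t) (g t)

theorem continuous_lift_iff {γ : C(I, X)} {g : I → G} :
    Continuous (h.lift γ g) ↔ IsHorizontal φ γ g := by
  rw [continuous_iff_continuousAt]
  refine forall_congr' fun t₀ => ?_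
  have h1 : ∀ t, (h.core.localTriv (γ t₀) (h.lift γ g t)).2 = g t * (φ (γ t₀) (γ t))⁻¹ := by
    intro t
    rw [FiberBundleCore.localTriv_apply]
    change g t * (φ (γ t) (γ t) * (φ (γ t₀) (γ t))⁻¹) = _
    rw [h.self, one_mul]
  have h2 : ContinuousAt (h.lift γ g) t₀ ↔ ContinuousAt γ t₀ ∧
      ContinuousAt (fun t => (h.core.localTriv (γ t₀) (h.lift γ g t)).2) t₀ :=
    FiberBundle.continuousAt_totalSpace (F := G) (E := h.core.Fiber) (h.lift γ g)
  rw [h2, and_iff_right γ.continuous.continuousAt, ContinuousAt, nhds_discrete G, tendsto_pure]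
  refine eventually_congr (Eventually.of_forall fun t => ?_)
  rw [h1, h1, h.self, inv_one, mul_one, mul_inv_eq_iff_eq_mul]

end

theorem exists_isHorizontal (h : IsLocalPotential N φ) (γ : C(I, X)) :
    ∃ g, g 0 = 1 ∧ IsHorizontal φ γ g := by
  let _ : TopologicalSpace G := ⊥
  have : DiscreteTopology G := ⟨rfl⟩
  let e := h.point (γ 0) 1
  let Γ := h.isCoveringMap.liftPath γ e rfl
  have hΓ : h.core.proj ∘ Γ = γ := h.isCoveringMap.liftPath_lifts γ e rfl
  have hΓ0 : Γ 0 = e := h.isCoveringMap.liftPath_zero γ e rfl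
  have heq : ⇑Γ = h.lift γ (fun t => h.label (Γ t)) := by
    funext t
    have : (Γ t).1 = γ t := congrFun hΓ t
    exact congrArg (fun x => h.point x (h.label (Γ t))) this
  refine ⟨fun t => h.label (Γ t), ?_, (h.continuous_lift_iff).1 (heq ▸ Γ.continuous)⟩
  exact congrArg h.label hΓ0

/-- Horizontal labellings are determined by their initial value, also along homotopies. -/
theorem IsHorizontal.eq_of_homotopic (h : IsLocalPotential N φ) {x y : X} {γ γ' : Path x y}
    (hγ : γ.Homotopic γ') {g g' : I → G} (hg : IsHorizontal φ γ g) (hg' : IsHorizontal φ γ' g')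
    (h0 : g 0 = g' 0) : g 1 = g' 1 := by
  let _ : TopologicalSpace G := ⊥
  have : DiscreteTopology G := ⟨rfl⟩
  let e := h.point x (g 0)
  have h1 : h.lift γ g = h.isCoveringMap.liftPath γ e γ.source :=
    (h.isCoveringMap.eq_liftPath_iff _).2 ⟨h.continuous_lift_iff.2 hg, rfl,
      congrArg (fun x => h.point x (g 0)) γ.source⟩
  have h2 : h.lift γ' g' = h.isCoveringMap.liftPath γ' e γ'.source :=
    (h.isCoveringMap.eq_liftPath_iff _).2 ⟨h.continuous_lift_iff.2 hg', rfl,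
      congrArg₂ h.point γ'.source h0.symm⟩
  have h3 := h.isCoveringMap.liftPath_apply_one_eq_of_homotopicRel hγ e γ.source γ'.source
  exact congrArg h.label ((congrFun h1 1).trans (h3.trans (congrFun h2 1).symm))

/-- A cocycle on `A` that agrees locally with the local potential has horizontal primitives. -/
theorem exists_isHorizontal_of_isPathCocycle (h : IsLocalPotential N φ) {A : Set X}
    {c : C(I, X) → G} (hc : IsPathCocycle A c)
    (hcφ : ∀ y, ∀ γ : C(I, X), (∀ t, γ t ∈ N y ∩ A) → c γ = (φ y (γ 0))⁻¹ * φ y (γ 1))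
    (γ : C(I, X)) (hγ : ∀ t, γ t ∈ A) :
    ∃ g, g 0 = 1 ∧ IsHorizontal φ γ g ∧ g 1 = c γ := by
  refine ⟨fun t => c (segmentPath (extendPath γ) (0, 0) ((t : ℝ), 0)), ?_, ?_, ?_⟩
  · exact hc.map_segmentPath_self (extendPath_mem hγ) _
  · intro t₀
    have h1 : (fun r : ℝ => γ (projIcc 0 1 zero_le_one r)) ⁻¹' N (γ t₀) ∈ 𝓝 (t₀ : ℝ) := by
      refine ((h.isOpen _).preimage (by fun_prop)).mem_nhds ?_
      simp only [mem_preimage, projIcc_val]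
      exact h.mem _
    obtain ⟨ε, hε, hεN⟩ := Metric.mem_nhds_iff.1 h1
    have h2 : ∀ᶠ t : I in 𝓝 t₀, (t : ℝ) ∈ ball (t₀ : ℝ) ε :=
      continuous_subtype_val.continuousAt.eventually (ball_mem_nhds _ hε)
    filter_upwards [h2] with t ht
    rw [← hc _ (extendPath_mem hγ) (0, 0) ((t₀ : ℝ), 0) ((t : ℝ), 0)]
    congr 1
    rw [hcφ (γ t₀)]
    · simp [extendPath, h.self]
    · intro s
      refine ⟨?_, hγ _⟩
      have h3 := (convex_ball (t₀ : ℝ) ε).lineMap_mem (mem_ball_self hε) ht s.2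
      have h4 := hεN h3
      have h5 : (AffineMap.lineMap ((t₀ : ℝ), (0 : ℝ)) ((t : ℝ), (0 : ℝ)) (s : ℝ)).1 =
          AffineMap.lineMap (t₀ : ℝ) (t : ℝ) (s : ℝ) := by
        simp [AffineMap.lineMap_apply]
      simpa [segmentPath_apply, extendPath, h5] using h4
  · exact congrArg c (segmentPath_extendPath γ 0 0)

end IsLocalPotential

/-- Van Kampen for a finite closed cover with locally contractible pieces and double intersections:
cocycles on the pieces that agree on the intersections come from a homotopy invariant transport
along all paths. -/
theorem exists_transport {ι : Type*} [Finite ι] {A : ι → Set X} {c : ι → C(I, X) → G}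
    (hclosed : ∀ i, IsClosed (A i)) (hcover : ∀ x, ∃ i, x ∈ A i)
    (hLC : ∀ i j, IsLocallyContractible (A i ∩ A j)) (hc : ∀ i, IsPathCocycle (A i) (c i))
    (hcompat : ∀ i j, ∀ γ : C(I, X), (∀ t, γ t ∈ A i ∩ A j) → c i γ = c j γ) :
    ∃ T : C(I, X) → G,
      (∀ {x y : X} (γ γ' : Path x y), γ.Homotopic γ' → T γ = T γ') ∧
      (∀ {x y z : X} (γ : Path x y) (γ' : Path y z), T (γ.trans γ') = T γ * T γ') ∧
      ∀ i γ, (∀ t, γ t ∈ A i) → T γ = c i γ := by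
  obtain ⟨N, φ, h, hφ⟩ := exists_isLocalPotential hclosed hcover hLC hc hcompat
  choose g hg0 hg using h.exists_isHorizontal
  have huniq : ∀ (γ : C(I, X)) (g' : I → G), IsLocalPotential.IsHorizontal φ γ g' →
      g' 1 = g' 0 * g γ 1 := by
    intro γ g' hg'
    let γ' : Path (γ 0) (γ 1) := ⟨γ, rfl, rfl⟩
    exact IsLocalPotential.IsHorizontal.eq_of_homotopic h (Path.Homotopic.refl γ')
      (g := g') (g' := fun t => g' 0 * g γ t) hg' ((hg γ).const_mul _) (by simp [hg0])
  refine ⟨fun γ => g γ 1, fun γ γ' hγ => ?_, fun γ γ' => ?_, fun i γ hγ => ?_⟩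
  · exact IsLocalPotential.IsHorizontal.eq_of_homotopic h hγ (hg _) (hg _) (by rw [hg0, hg0])
  · let θ : ℝ → ℝ → C(I, I) := fun a b =>
      segmentPath ⟨fun q => projIcc 0 1 zero_le_one q.1, by fun_prop⟩ (a, 0) (b, 0)
    have e1 := huniq _ _ ((hg (γ.trans γ')).comp (θ 0 (1 / 2)))
    have e2 := huniq _ _ ((hg (γ.trans γ')).comp (θ (1 / 2) 1))
    have e3 : (γ.trans γ' : C(I, X)).comp (θ 0 (1 / 2)) = γ :=
      segmentPath_extendPath_trans_left γ γ'
    have e4 : (γ.trans γ' : C(I, X)).comp (θ (1 / 2) 1) = γ' :=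
      segmentPath_extendPath_trans_right γ γ'
    have t1 : θ 0 (1 / 2) 0 = 0 := by simp [θ]
    have t2 : θ (1 / 2) 1 0 = θ 0 (1 / 2) 1 := by simp [θ]
    have t3 : θ (1 / 2) 1 1 = 1 := by simp [θ]
    rw [e3] at e1
    rw [e4] at e2
    simp only [Function.comp_apply, t1, t2, t3, hg0, one_mul] at e1 e2
    exact e2.trans (congrArg (· * g γ' 1) e1)
  · obtain ⟨g', hg'0, hg', hg'1⟩ :=
      h.exists_isHorizontal_of_isPathCocycle (hc i) (fun y => hφ y i) γ hγ
    rw [← hg'1, huniq γ g' hg', hg'0, one_mul]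

end LargeGroups

end

/-! ### Labellings and surjections onto free products -/

noncomputable section

open Set Filter Topology Metric

namespace LargeGroups

open scoped unitInterval

variable {X : Type*} [TopologicalSpace X] {V W : Type*} [AddCommGroup V] [AddCommGroup W]

/-- Path cocycles with values in an additive group. -/
def IsAddPathCocycle (A : Set X) (c : C(I, X) → V) : Prop :=
  IsPathCocycle A fun γ => Multiplicative.ofAdd (c γ)

namespace IsAddPathCocycle

variable {A : Set X} {c : C(I, X) → V}

theorem map_segmentPath (hc : IsAddPathCocycle A c) {f : C(ℝ × ℝ, X)} (hf : ∀ q, f q ∈ A)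
    (u v w : ℝ × ℝ) :
    c (segmentPath f u v) + c (segmentPath f v w) = c (segmentPath f u w) :=
  hc f hf u v w

theorem map_trans (hc : IsAddPathCocycle A c) {x y z : X} (γ : Path x y) (γ' : Path y z)
    (h : ∀ t, γ t ∈ A) (h' : ∀ t, γ' t ∈ A) : c (γ.trans γ') = c γ + c γ' :=
  IsPathCocycle.map_trans hc γ γ' h h'

theorem map_refl (hc : IsAddPathCocycle A c) {x : X} (hx : x ∈ A) : c (Path.refl x) = 0 :=
  IsPathCocycle.map_refl hc hx

theorem map_symm (hc : IsAddPathCocycle A c) {x y : X} (γ : Path x y) (h : ∀ t, γ t ∈ A) :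
    c γ.symm = -c γ :=
  IsPathCocycle.map_symm hc γ h

theorem mono (hc : IsAddPathCocycle A c) {D : Set X} (h : D ⊆ A) : IsAddPathCocycle D c :=
  fun f hf => hc f fun q => h (hf q)

end IsAddPathCocycle

theorem forall_trans_mem {A : Set X} {x y z : X} {γ : Path x y} {γ' : Path y z}
    (h : ∀ t, γ t ∈ A) (h' : ∀ t, γ' t ∈ A) (t : I) : γ.trans γ' t ∈ A := by
  have : γ.trans γ' t ∈ range (γ.trans γ') := ⟨t, rfl⟩
  rw [Path.trans_range] at this
  rcases this with ⟨s, hs⟩ | ⟨s, hs⟩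
  · exact hs ▸ h s
  · exact hs ▸ h' s

theorem forall_symm_mem {A : Set X} {x y : X} {γ : Path x y} (h : ∀ t, γ t ∈ A) (t : I) :
    γ.symm t ∈ A := h _

/-- A cocycle on `A` that vanishes on `A ∩ D`, such that the values of loops generate `V` and any
two points in a path component of `A` are joined by a path with label zero. -/
structure IsFullLabelling (A D : Set X) (c : C(I, X) → V) : Prop where
  cocycle : IsAddPathCocycle A c
  eq_zero : ∀ γ : C(I, X), (∀ t, γ t ∈ A ∩ D) → c γ = 0
  exists_path : ∀ x y, JoinedIn A x y → ∃ γ : Path x y, (∀ t, γ t ∈ A) ∧ c γ = 0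
  closure_eq : AddSubgroup.closure {v | ∃ (x : X) (γ : Path x x), (∀ t, γ t ∈ A) ∧ c γ = v} = ⊤

section Transport

variable {G : Type*} [Group G] {T : C(I, X) → G}

/-- The homomorphism on the fundamental group given by a homotopy invariant transport `T`. The
inverse accounts for multiplication in `FundamentalGroup` being composition of paths in reverse
order. -/
def transportHom (h1 : ∀ {x y : X} (γ γ' : Path x y), γ.Homotopic γ' → T γ = T γ')
    (h2 : ∀ {x y z : X} (γ : Path x y) (γ' : Path y z), T (γ.trans γ') = T γ * T γ') (x : X) :
    FundamentalGroup X x →* G :=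
  MonoidHom.mk' (fun p => (Quotient.lift (fun γ : Path x x => T γ) h1 p)⁻¹) (by
    intro p q
    induction p using Quotient.ind
    induction q using Quotient.ind
    rename_i γ γ'
    refine Eq.trans ?_ (mul_inv_rev _ _)
    exact congrArg _ (h2 γ' γ))

theorem transportHom_mk (h1 : ∀ {x y : X} (γ γ' : Path x y), γ.Homotopic γ' → T γ = T γ')
    (h2 : ∀ {x y z : X} (γ : Path x y) (γ' : Path y z), T (γ.trans γ') = T γ * T γ') {x : X}
    (γ : Path x x) : transportHom h1 h2 x (Path.Homotopic.Quotient.mk γ) = (T γ)⁻¹ := rfl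

/-- If nearby points are joined by paths with trivial transport, then so are any two points of a
connected space. -/
theorem exists_path_transport_eq_one [ConnectedSpace X]
    (h1 : ∀ {x y : X} (γ γ' : Path x y), γ.Homotopic γ' → T γ = T γ')
    (h2 : ∀ {x y z : X} (γ : Path x y) (γ' : Path y z), T (γ.trans γ') = T γ * T γ')
    (h : ∀ y : X, ∀ᶠ z in 𝓝 y, ∃ γ : Path y z, T γ = 1) (x y : X) : ∃ γ : Path x y, T γ = 1 := by
  have hrefl : ∀ x : X, T (Path.refl x) = 1 := fun x => by
    have := h2 (Path.refl x) (Path.refl x)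
    rwa [Path.refl_trans_refl, left_eq_mul] at this
  have hsymm : ∀ {x y : X} (γ : Path x y), T γ = 1 → T γ.symm = 1 := fun {x y} γ hγ => by
    have := h2 γ γ.symm
    rw [← h1 _ _ ⟨Path.Homotopy.reflTransSymm γ⟩, hrefl, hγ, one_mul] at this
    exact this.symm
  have hclopen : IsClopen {z | ∃ γ : Path x z, T γ = 1} := by
    constructor
    · rw [← isOpen_compl_iff, isOpen_iff_mem_nhds]
      intro y hy
      filter_upwards [h y] with z hz hz'
      obtain ⟨γ, hγ⟩ := hz
      obtain ⟨γ', hγ'⟩ := hz'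
      exact hy ⟨γ'.trans γ.symm, by rw [h2, hγ', hsymm γ hγ, mul_one]⟩
    · rw [isOpen_iff_mem_nhds]
      rintro y ⟨γ, hγ⟩
      filter_upwards [h y] with z hz
      obtain ⟨γ', hγ'⟩ := hz
      exact ⟨γ.trans γ', by rw [h2, hγ, hγ', mul_one]⟩
  have : y ∈ {z | ∃ γ : Path x z, T γ = 1} :=
    hclopen.eq_univ ⟨x, Path.refl x, hrefl x⟩ ▸ mem_univ y
  exact this

end Transport

theorem range_le_of_closure_eq_top {G : Type*} [Group G] (g : Multiplicative V →* G)
    (R : Subgroup G) {S : Set V} (hS : AddSubgroup.closure S = ⊤)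
    (h : ∀ v ∈ S, g (Multiplicative.ofAdd v) ∈ R) : g.range ≤ R := by
  have : AddSubgroup.closure S ≤ Subgroup.toAddSubgroup' (R.comap g) :=
    (AddSubgroup.closure_le _).2 h
  rintro _ ⟨v, rfl⟩
  exact this (hS ▸ AddSubgroup.mem_top v.toAdd)

/-- Full labellings of `A` and `B` with values in `V` and `W` give a surjection of the fundamental
group of `A ∪ B` onto `V * W`. -/
theorem exists_surjective_coprod [ConnectedSpace X] {A B : Set X} (hA : IsClosed A)
    (hB : IsClosed B) (hAB : A ∪ B = univ) (hAc : IsLocallyContractible A)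
    (hBc : IsLocallyContractible B) (hABc : IsLocallyContractible (A ∩ B))
    {c : C(I, X) → V} {d : C(I, X) → W} (hc : IsFullLabelling A B c) (hd : IsFullLabelling B A d)
    (x : X) : ∃ f : FundamentalGroup X x →* Monoid.Coprod (Multiplicative V) (Multiplicative W),
      Function.Surjective f := by
  let S : Bool → Set X := fun b => cond b A B
  let e : Bool → C(I, X) → Monoid.Coprod (Multiplicative V) (Multiplicative W) := fun b γ =>
    cond b (Monoid.Coprod.inl (Multiplicative.ofAdd (c γ)))
      (Monoid.Coprod.inr (Multiplicative.ofAdd (d γ)))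
  have hS : ∀ b, IsClosed (S b) := by rintro (_ | _) <;> assumption
  have hcov : ∀ z, ∃ b, z ∈ S b := fun z => by
    rcases (hAB ▸ mem_univ z : z ∈ A ∪ B) with h | h
    · exact ⟨true, h⟩
    · exact ⟨false, h⟩
  have hSc : ∀ b, IsLocallyContractible (S b) := by rintro (_ | _) <;> assumption
  have he : ∀ b, IsPathCocycle (S b) (e b) := by
    rintro (_ | _) f hf u v w
    · exact (map_mul _ _ _).symm.trans (congrArg _ (hd.cocycle f hf u v w))
    · exact (map_mul _ _ _).symm.trans (congrArg _ (hc.cocycle f hf u v w))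
  have hone : ∀ b γ, (∀ t, γ t ∈ A ∩ B) → e b γ = 1 := by
    rintro (_ | _) γ hγ
    · change Monoid.Coprod.inr (Multiplicative.ofAdd (d γ)) = 1
      rw [hd.eq_zero γ fun t => (hγ t).symm, ofAdd_zero, map_one]
    · change Monoid.Coprod.inl (Multiplicative.ofAdd (c γ)) = 1
      rw [hc.eq_zero γ hγ, ofAdd_zero, map_one]
  obtain ⟨T, h1, h2, hT⟩ := exists_transport hS hcov (c := e)
    (by rintro (_ | _) (_ | _) <;> simpa [S, inter_comm]) he
    (by
      rintro (_ | _) (_ | _) γ hγ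
      · rfl
      · rw [hone _ _ fun t => (hγ t).symm, hone _ _ fun t => (hγ t).symm]
      · rw [hone _ _ hγ, hone _ _ hγ]
      · rfl)
  have hlocal : ∀ y : X, ∀ᶠ z in 𝓝 y, ∃ γ : Path y z, T γ = 1 := by
    intro y
    have h3 : ∀ᶠ z in 𝓝 y, ∀ b, z ∈ S b → JoinedIn (S b) y z := by
      rw [eventually_all]
      intro b
      by_cases hy : y ∈ S b
      · simpa using (hSc b).eventually_joinedIn hy univ_mem
      · filter_upwards [(hS b).isOpen_compl.mem_nhds hy] with z hz hz' using absurd hz' hz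
    filter_upwards [h3] with z hz
    obtain ⟨b, hb⟩ := hcov z
    have h4 : ∃ γ : Path y z, (∀ t, γ t ∈ S b) ∧ e b γ = 1 := by
      cases b
      · obtain ⟨γ, hγ, h0⟩ := hd.exists_path _ _ (hz false hb)
        refine ⟨γ, hγ, ?_⟩
        change Monoid.Coprod.inr (Multiplicative.ofAdd (d γ)) = 1
        rw [h0, ofAdd_zero, map_one]
      · obtain ⟨γ, hγ, h0⟩ := hc.exists_path _ _ (hz true hb)
        refine ⟨γ, hγ, ?_⟩
        change Monoid.Coprod.inl (Multiplicative.ofAdd (c γ)) = 1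
        rw [h0, ofAdd_zero, map_one]
    obtain ⟨γ, hγ, h0⟩ := h4
    exact ⟨γ, (hT b γ hγ).trans h0⟩
  have hpath := exists_path_transport_eq_one h1 h2 hlocal
  let f := transportHom h1 h2 x
  have hloop : ∀ b (z : X) (γ : Path z z), (∀ t, γ t ∈ S b) → e b γ ∈ f.range := by
    intro b z γ hγ
    obtain ⟨δ, hδ⟩ := hpath x z
    obtain ⟨δ', hδ'⟩ := hpath z x
    have : f (Path.Homotopic.Quotient.mk ((δ.trans γ).trans δ')) = (e b γ)⁻¹ := by
      rw [transportHom_mk, h2, h2, hδ, hδ', one_mul, mul_one, hT b γ hγ]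
    exact inv_mem_iff.1 (this ▸ ⟨_, rfl⟩)
  have hinl := range_le_of_closure_eq_top (Monoid.Coprod.inl (N := Multiplicative W)) f.range
    hc.closure_eq (by rintro _ ⟨z, γ, hγ, rfl⟩; exact hloop true z γ hγ)
  have hinr := range_le_of_closure_eq_top (Monoid.Coprod.inr (M := Multiplicative V)) f.range
    hd.closure_eq (by rintro _ ⟨z, γ, hγ, rfl⟩; exact hloop false z γ hγ)
  refine ⟨f, MonoidHom.range_eq_top.1 (eq_top_iff.2 ?_)⟩
  rw [← Monoid.Coprod.range_inl_sup_range_inr]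
  exact sup_le hinl hinr

end LargeGroups

end

/-! ### Construction of full labellings -/

noncomputable section

open Set Filter Topology Metric

namespace LargeGroups

open scoped unitInterval

variable {X : Type*} [TopologicalSpace X] {V : Type*} [AddCommGroup V]

namespace IsAddPathCocycle

variable {A D : Set X} {c : C(I, X) → V}

/-- A cocycle that vanishes on loops is a coboundary. -/
theorem exists_primitive (hc : IsAddPathCocycle A c)
    (h : ∀ (x : X) (γ : Path x x), (∀ t, γ t ∈ A) → c γ = 0) :
    ∃ f : X → V, ∀ γ : C(I, X), (∀ t, γ t ∈ A) → c γ = f (γ 1) - f (γ 0) := by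
  classical
  rcases isEmpty_or_nonempty X with hX | hX
  · exact ⟨fun _ => 0, fun γ => (hX.false (γ 0)).elim⟩
  -- a base point of each path component
  let b : X → X := fun z => Classical.epsilon fun w => JoinedIn A w z
  have hb : ∀ {y z}, JoinedIn A y z → b y = b z := by
    intro y z hyz
    exact congrArg (fun P : X → Prop => Classical.epsilon P) (funext fun w =>
      propext ⟨fun hw : JoinedIn A w y => hw.trans hyz, fun hw => hw.trans hyz.symm⟩)
  have hbz : ∀ {z}, z ∈ A → JoinedIn A (b z) z := fun {z} hz =>
    Classical.epsilon_spec (p := fun w => JoinedIn A w z) ⟨z, JoinedIn.refl hz⟩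
  have huniq : ∀ {y z : X} (δ δ' : Path y z), (∀ t, δ t ∈ A) → (∀ t, δ' t ∈ A) →
      c δ = c δ' := by
    intro y z δ δ' hδ hδ'
    have := h y (δ.trans δ'.symm) (forall_trans_mem hδ (forall_symm_mem hδ'))
    rw [hc.map_trans _ _ hδ (forall_symm_mem hδ'), hc.map_symm _ hδ', ← sub_eq_add_neg] at this
    exact sub_eq_zero.1 this
  let f : X → V := fun z => if h : JoinedIn A (b z) z then c h.somePath else 0
  have hf : ∀ (w z : X), w = b z → ∀ δ : Path w z, (∀ t, δ t ∈ A) → f z = c δ := by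
    rintro _ z rfl δ hδ
    have hj : JoinedIn A (b z) z := ⟨δ, hδ⟩
    simp only [f, dif_pos hj]
    exact huniq _ _ hj.somePath_mem hδ
  refine ⟨f, fun γ hγ => ?_⟩
  let γ' : Path (γ 0) (γ 1) := ⟨γ, rfl, rfl⟩
  obtain ⟨δ, hδ⟩ := hbz (hγ 0)
  rw [hf _ _ rfl δ hδ, hf _ _ (hb ⟨γ', hγ⟩) (δ.trans γ') (forall_trans_mem hδ hγ),
    hc.map_trans _ _ hδ hγ]
  change c γ = c δ + c γ - c δ
  abel

theorem sub_coboundary (hc : IsAddPathCocycle A c) (f : X → V) :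
    IsAddPathCocycle A fun γ => c γ - (f (γ 1) - f (γ 0)) := by
  intro F hF u v w
  change c _ - _ + (c _ - _) = c _ - _
  rw [← hc.map_segmentPath hF u v w]
  simp only [segmentPath_zero, segmentPath_one]
  abel

/-- A cocycle that vanishes on the loops of `A ∩ D` can be changed by a coboundary so that it
vanishes on all paths of `A ∩ D`. -/
theorem exists_normalization (hc : IsAddPathCocycle A c)
    (h : ∀ (x : X) (γ : Path x x), (∀ t, γ t ∈ A ∩ D) → c γ = 0) :
    ∃ c' : C(I, X) → V, IsAddPathCocycle A c' ∧ (∀ γ : C(I, X), (∀ t, γ t ∈ A ∩ D) → c' γ = 0) ∧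
      ∀ (x : X) (γ : Path x x), c' γ = c γ := by
  obtain ⟨f, hf⟩ := (hc.mono inter_subset_left).exists_primitive h
  refine ⟨_, hc.sub_coboundary f, fun γ hγ => by rw [hf γ hγ, sub_self], fun x γ => ?_⟩
  have h0 : (γ : C(I, X)) 0 = x := γ.source
  have h1 : (γ : C(I, X)) 1 = x := γ.target
  simp only [h0, h1, sub_self, sub_zero]

open Classical in
/-- The restriction of a labelling to the paths in the path component of `a` in `A`. -/
def restrictComponent (A : Set X) (a : X) (c : C(I, X) → V) (γ : C(I, X)) : V :=
  if JoinedIn A a (γ 0) then c γ else 0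

theorem restrictComponent_isAddPathCocycle (hc : IsAddPathCocycle A c) (a : X) :
    IsAddPathCocycle A (restrictComponent A a c) := by
  intro F hF u v w
  change restrictComponent A a c _ + restrictComponent A a c _ = restrictComponent A a c _
  have huv : JoinedIn A (F u) (F v) :=
    ⟨⟨segmentPath F u v, segmentPath_zero _ _ _, segmentPath_one _ _ _⟩, fun t => hF _⟩
  have hu : (segmentPath F u v) 0 = F u := segmentPath_zero _ _ _
  have hu' : (segmentPath F u w) 0 = F u := segmentPath_zero _ _ _
  have hv : (segmentPath F v w) 0 = F v := segmentPath_zero _ _ _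
  by_cases h : JoinedIn A a (F u)
  · rw [restrictComponent, restrictComponent, restrictComponent, if_pos (hu ▸ h),
      if_pos (hv ▸ h.trans huv), if_pos (hu' ▸ h), hc.map_segmentPath hF u v w]
  · rw [restrictComponent, restrictComponent, restrictComponent, if_neg (hu ▸ h),
      if_neg (hv ▸ fun h' => h (h'.trans huv.symm)), if_neg (hu' ▸ h), add_zero]

/-- If a cocycle takes all values on the loops at `a`, then its restriction to the path component of
`a` is a full labelling. -/
theorem isFullLabelling_restrictComponent (hc : IsAddPathCocycle A c)
    (h0 : ∀ γ : C(I, X), (∀ t, γ t ∈ A ∩ D) → c γ = 0) {a : X} (ha : a ∈ A)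
    (hsurj : ∀ v, ∃ γ : Path a a, (∀ t, γ t ∈ A) ∧ c γ = v) :
    IsFullLabelling A D (restrictComponent A a c) where
  cocycle := hc.restrictComponent_isAddPathCocycle a
  eq_zero γ hγ := by rw [restrictComponent, h0 γ hγ, ite_self]
  exists_path := by
    rintro x y ⟨δ, hδ⟩
    by_cases hx : JoinedIn A a x
    · obtain ⟨ρ, hρ⟩ := hx
      obtain ⟨γ, hγ, hcγ⟩ := hsurj (-c δ)
      refine ⟨((ρ.symm.trans γ).trans ρ).trans δ, forall_trans_mem (forall_trans_mem
        (forall_trans_mem (forall_symm_mem hρ) hγ) hρ) hδ, ?_⟩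
      rw [restrictComponent]
      split_ifs
      · rw [hc.map_trans _ _ (forall_trans_mem (forall_trans_mem (forall_symm_mem hρ) hγ) hρ) hδ,
          hc.map_trans _ _ (forall_trans_mem (forall_symm_mem hρ) hγ) hρ,
          hc.map_trans _ _ (forall_symm_mem hρ) hγ, hc.map_symm _ hρ, hcγ]
        abel
      · rfl
    · refine ⟨δ, hδ, if_neg ?_⟩
      change ¬ JoinedIn A a (δ 0)
      rwa [δ.source]
  closure_eq := by
    refine eq_top_iff.2 fun v _ => AddSubgroup.subset_closure ?_
    obtain ⟨γ, hγ, rfl⟩ := hsurj v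
    refine ⟨a, γ, hγ, if_pos ?_⟩
    change JoinedIn A a (γ 0)
    rw [γ.source]
    exact JoinedIn.refl ha

/-- The values of a cocycle on the loops at `a`. -/
def loopValues (hc : IsAddPathCocycle A c) {a : X} (ha : a ∈ A) : AddSubgroup V where
  carrier := {v | ∃ γ : Path a a, (∀ t, γ t ∈ A) ∧ c γ = v}
  zero_mem' := ⟨Path.refl a, fun _ => ha, hc.map_refl ha⟩
  add_mem' := by
    rintro _ _ ⟨γ, hγ, rfl⟩ ⟨γ', hγ', rfl⟩
    exact ⟨γ.trans γ', forall_trans_mem hγ hγ', hc.map_trans _ _ hγ hγ'⟩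
  neg_mem' := by
    rintro _ ⟨γ, hγ, rfl⟩
    exact ⟨γ.symm, forall_symm_mem hγ, hc.map_symm _ hγ⟩

end IsAddPathCocycle

open IsAddPathCocycle

variable {A D : Set X} {p : ℕ} [Fact p.Prime]

/-- A mod `p` cocycle that is nonzero on a loop at `a` takes all values on the loops at `a`. -/
theorem exists_loop_of_ne_zero {c : C(I, X) → ZMod p} (hc : IsAddPathCocycle A c) {a : X}
    {γ : Path a a} (hγ : ∀ t, γ t ∈ A) (h : c γ ≠ 0) (v : ZMod p) :
    ∃ γ' : Path a a, (∀ t, γ' t ∈ A) ∧ c γ' = v := by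
  have ha : a ∈ A := γ.source ▸ hγ 0
  have h1 : c γ ∈ hc.loopValues ha := ⟨γ, hγ, rfl⟩
  have h2 := nsmul_mem h1 (v / c γ).val
  rw [nsmul_eq_mul, ZMod.natCast_zmod_val, div_mul_cancel₀ _ h] at h2
  exact h2

theorem exists_isFullLabelling {c : C(I, X) → ZMod p} (hc : IsAddPathCocycle A c)
    (h0 : ∀ (x : X) (γ : Path x x), (∀ t, γ t ∈ A ∩ D) → c γ = 0)
    (h : ∃ (x : X) (γ : Path x x), (∀ t, γ t ∈ A) ∧ c γ ≠ 0) :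
    ∃ c' : C(I, X) → ZMod p, IsFullLabelling A D c' := by
  obtain ⟨c', hc', hc'0, hloop⟩ := hc.exists_normalization h0
  obtain ⟨a, γ, hγ, hne⟩ := h
  exact ⟨_, hc'.isFullLabelling_restrictComponent hc'0 (γ.source ▸ hγ 0 : a ∈ A)
    (exists_loop_of_ne_zero hc' hγ (by rwa [hloop]))⟩

/-- Some nonzero linear functional on the plane vanishes on each proper subgroup of `𝔽_p × 𝔽_p`. -/
theorem exists_linear_relation {L : AddSubgroup (ZMod p × ZMod p)} (hL : L ≠ ⊤) :
    ∃ s t : ZMod p, (s, t) ≠ (0, 0) ∧ ∀ v ∈ L, s * v.1 + t * v.2 = 0 := by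
  have hlt : AddSubgroup.toZModSubmodule p L < ⊤ := by
    rw [lt_top_iff_ne_top]
    intro h
    exact hL ((map_eq_top_iff (AddSubgroup.toZModSubmodule p)).1 h)
  obtain ⟨f, hf, hle⟩ := Submodule.exists_le_ker_of_lt_top _ hlt
  have hexp : ∀ v, f v = f (1, 0) * v.1 + f (0, 1) * v.2 := by
    rintro ⟨x, y⟩
    have : ((x, y) : ZMod p × ZMod p) = x • (1, 0) + y • (0, 1) := by simp
    rw [this, map_add, map_smul, map_smul]
    simp [mul_comm]
  refine ⟨f (1, 0), f (0, 1), ?_, fun v hv => ?_⟩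
  · intro h
    simp only [Prod.mk.injEq] at h
    exact hf (LinearMap.ext fun v => by
      rw [hexp, h.1, h.2, zero_mul, zero_mul, add_zero, LinearMap.zero_apply])
  · rw [← hexp]
    exact hle hv

/-- Two independent classes give a full labelling with values in the plane. Either they are
independent on the loops at one point, or some combination of them vanishes on one path component
but not on another, and the two components then carry one coordinate each. -/
theorem exists_isFullLabelling_prod {c₁ c₂ : C(I, X) → ZMod p} (hc₁ : IsAddPathCocycle A c₁)
    (hc₂ : IsAddPathCocycle A c₂)
    (h₁ : ∀ (x : X) (γ : Path x x), (∀ t, γ t ∈ A ∩ D) → c₁ γ = 0)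
    (h₂ : ∀ (x : X) (γ : Path x x), (∀ t, γ t ∈ A ∩ D) → c₂ γ = 0)
    (h : ∀ s t : ZMod p, (s, t) ≠ (0, 0) →
      ∃ (x : X) (γ : Path x x), (∀ r, γ r ∈ A) ∧ s * c₁ γ + t * c₂ γ ≠ 0) :
    ∃ c' : C(I, X) → ZMod p × ZMod p, IsFullLabelling A D c' := by
  obtain ⟨d₁, hd₁, hd₁0, hloop₁⟩ := hc₁.exists_normalization h₁
  obtain ⟨d₂, hd₂, hd₂0, hloop₂⟩ := hc₂.exists_normalization h₂
  have h' : ∀ s t : ZMod p, (s, t) ≠ (0, 0) →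
      ∃ (x : X) (γ : Path x x), (∀ r, γ r ∈ A) ∧ s * d₁ γ + t * d₂ γ ≠ 0 := by
    intro s t hst
    obtain ⟨x, γ, hγ, hne⟩ := h s t hst
    exact ⟨x, γ, hγ, by rwa [hloop₁, hloop₂]⟩
  obtain ⟨a, γ, hγ, hne⟩ := h' 1 0 (by simp)
  rw [one_mul, zero_mul, add_zero] at hne
  have ha : a ∈ A := γ.source ▸ hγ 0
  have hd : IsAddPathCocycle A fun γ => (d₁ γ, d₂ γ) := fun f hf u v w =>
    Prod.ext (hd₁.map_segmentPath hf u v w) (hd₂.map_segmentPath hf u v w)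
  by_cases htop : hd.loopValues ha = ⊤
  · exact ⟨_, hd.isFullLabelling_restrictComponent
      (fun γ hγ => Prod.ext (hd₁0 γ hγ) (hd₂0 γ hγ)) ha
      fun v => (htop ▸ AddSubgroup.mem_top v : v ∈ hd.loopValues ha)⟩
  obtain ⟨s, t, hst, hrel⟩ := exists_linear_relation htop
  obtain ⟨b, δ, hδ, hδne⟩ := h' s t hst
  have he : IsAddPathCocycle A fun γ => s * d₁ γ + t * d₂ γ := by
    intro f hf u v w
    change s * d₁ _ + t * d₂ _ + (s * d₁ _ + t * d₂ _) = s * d₁ _ + t * d₂ _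
    rw [← hd₁.map_segmentPath hf u v w, ← hd₂.map_segmentPath hf u v w]
    ring
  have hab : ¬ JoinedIn A a b := by
    rintro ⟨ρ, hρ⟩
    have h1 := hrel _ ⟨(ρ.trans δ).trans ρ.symm, forall_trans_mem (forall_trans_mem hρ hδ)
      (forall_symm_mem hρ), rfl⟩
    have h2 := he.map_trans (ρ.trans δ) ρ.symm (forall_trans_mem hρ hδ) (forall_symm_mem hρ)
    rw [he.map_trans _ _ hρ hδ, he.map_symm _ hρ] at h2
    refine hδne ?_
    rw [h1] at h2
    linear_combination -h2
  have hb : b ∈ A := δ.source ▸ hδ 0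
  have f₁ := hd₁.isFullLabelling_restrictComponent hd₁0 ha (exists_loop_of_ne_zero hd₁ hγ hne)
  have f₂ := he.isFullLabelling_restrictComponent
    (D := D) (fun γ hγ => by rw [hd₁0 γ hγ, hd₂0 γ hγ, mul_zero, mul_zero, add_zero]) hb
    (exists_loop_of_ne_zero he hδ hδne)
  have z₁ : ∀ {x y : X} (γ : Path x y), ¬ JoinedIn A a x → restrictComponent A a d₁ γ = 0 := by
    intro x y γ hx
    refine if_neg ?_
    change ¬ JoinedIn A a (γ 0)
    rwa [γ.source]
  have z₂ : ∀ {x y : X} (γ : Path x y), ¬ JoinedIn A b x →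
      restrictComponent A b (fun γ => s * d₁ γ + t * d₂ γ) γ = 0 := by
    intro x y γ hx
    refine if_neg ?_
    change ¬ JoinedIn A b (γ 0)
    rwa [γ.source]
  refine ⟨fun γ => (restrictComponent A a d₁ γ,
    restrictComponent A b (fun γ => s * d₁ γ + t * d₂ γ) γ), ⟨?_, ?_, ?_, ?_⟩⟩
  · exact fun f hf u v w => Prod.ext (f₁.cocycle.map_segmentPath hf u v w)
      (f₂.cocycle.map_segmentPath hf u v w)
  · exact fun γ hγ => Prod.ext (f₁.eq_zero γ hγ) (f₂.eq_zero γ hγ)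
  · intro x y hxy
    by_cases hx : JoinedIn A a x
    · obtain ⟨γ', hγ', h0⟩ := f₁.exists_path x y hxy
      exact ⟨γ', hγ', Prod.ext h0 (z₂ γ' fun hbx => hab (hx.trans hbx.symm))⟩
    · obtain ⟨γ', hγ', h0⟩ := f₂.exists_path x y hxy
      exact ⟨γ', hγ', Prod.ext (z₁ γ' hx) h0⟩
  · have haa : JoinedIn A a a := JoinedIn.refl ha
    have hbb : JoinedIn A b b := JoinedIn.refl hb
    refine eq_top_iff.2 ?_
    rintro ⟨v, w⟩ -
    rw [← add_zero v, ← zero_add w, ← Prod.mk_add_mk]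
    refine add_mem (AddSubgroup.subset_closure ?_) (AddSubgroup.subset_closure ?_)
    · obtain ⟨γ', hγ', rfl⟩ := exists_loop_of_ne_zero hd₁ hγ hne v
      refine ⟨a, γ', hγ', Prod.ext (if_pos ?_) (z₂ γ' fun h => hab h.symm)⟩
      change JoinedIn A a (γ' 0)
      rwa [γ'.source]
    · obtain ⟨γ', hγ', hv⟩ := exists_loop_of_ne_zero he hδ hδne w
      refine ⟨b, γ', hγ', Prod.ext (z₁ γ' hab) (Eq.trans (if_pos ?_) hv)⟩
      change JoinedIn A b (γ' 0)
      rwa [γ'.source]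

end LargeGroups

end

/-! ### Free products of two groups -/

noncomputable section

namespace LargeGroups

section FreeProduct

open Monoid.Coprod

variable (V W : Type) [Group V] [Group W]

/-- The pairs of nontrivial elements; the kernel of `V * W → V × W` is free on them. -/
abbrev NontrivialPairs : Type := {v : V // v ≠ 1} × {w : W // w ≠ 1}

variable {V W}

open Classical in
/-- The generator of the free group that belongs to a pair, or `1` if an entry is trivial. -/
def pairGenerator (v : V) (w : W) : FreeGroup (NontrivialPairs V W) :=
  if h : v ≠ 1 ∧ w ≠ 1 then FreeGroup.of (⟨v, h.1⟩, ⟨w, h.2⟩) else 1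

theorem pairGenerator_one_left (w : W) : pairGenerator (1 : V) w = 1 := by simp [pairGenerator]

theorem pairGenerator_one_right (v : V) : pairGenerator v (1 : W) = 1 := by simp [pairGenerator]

variable (V W)

/-- The action of `V * W` on `F × V × W`, for the free group `F` on the pairs of nontrivial
elements, in which `V` acts by translation and `W` acts by translation twisted by the coboundary of
`pairGenerator`. It is the permutation representation induced from an epimorphism of the kernel of
`V * W → V × W` onto `F`. -/
def inducedAction : Monoid.Coprod V W →* Function.End (FreeGroup (NontrivialPairs V W) × V × W) :=
  lift
    { toFun := fun v q => (q.1, v * q.2.1, q.2.2)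
      map_one' := by funext q; simp; rfl
      map_mul' := fun v v' => by
        funext q
        change _ = (_, v * (v' * q.2.1), _)
        rw [mul_assoc] }
    { toFun := fun w q => (pairGenerator q.2.1 (w * q.2.2) * (pairGenerator q.2.1 q.2.2)⁻¹ * q.1,
        q.2.1, w * q.2.2)
      map_one' := by funext q; simp; rfl
      map_mul' := fun w w' => by
        funext q
        change _ = (pairGenerator q.2.1 (w * (w' * q.2.2)) *
          (pairGenerator q.2.1 (w' * q.2.2))⁻¹ * (pairGenerator q.2.1 (w' * q.2.2) *
            (pairGenerator q.2.1 q.2.2)⁻¹ * q.1), _, w * (w' * q.2.2))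
        simp only [mul_assoc, inv_mul_cancel_left] }

variable {V W}

theorem inducedAction_inl (v : V) (q : FreeGroup (NontrivialPairs V W) × V × W) :
    inducedAction V W (inl v) q = (q.1, v * q.2.1, q.2.2) := by
  rw [inducedAction, lift_apply_inl]; rfl

theorem inducedAction_inr (w : W) (q : FreeGroup (NontrivialPairs V W) × V × W) :
    inducedAction V W (inr w) q =
      (pairGenerator q.2.1 (w * q.2.2) * (pairGenerator q.2.1 q.2.2)⁻¹ * q.1,
        q.2.1, w * q.2.2) := by
  rw [inducedAction, lift_apply_inr]; rfl

theorem inducedAction_mul (g h : Monoid.Coprod V W)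
    (q : FreeGroup (NontrivialPairs V W) × V × W) :
    inducedAction V W (g * h) q = inducedAction V W g (inducedAction V W h q) := by
  rw [map_mul]; rfl

theorem inducedAction_snd (g : Monoid.Coprod V W) (q : FreeGroup (NontrivialPairs V W) × V × W) :
    (inducedAction V W g q).2 = toProd g * q.2 := by
  induction g using Monoid.Coprod.induction_on generalizing q with
  | inl v => rw [inducedAction_inl]; simp [Prod.ext_iff]
  | inr w => rw [inducedAction_inr]; simp [Prod.ext_iff]
  | mul g h hg hh => rw [inducedAction_mul, hg, hh, map_mul, mul_assoc]

/-- The action commutes with right multiplication by the free group. -/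
theorem inducedAction_mul_right (g : Monoid.Coprod V W) (t s : FreeGroup (NontrivialPairs V W))
    (q : V × W) : inducedAction V W g (t * s, q) =
      ((inducedAction V W g (t, q)).1 * s, (inducedAction V W g (t, q)).2) := by
  induction g using Monoid.Coprod.induction_on generalizing t q with
  | inl v => simp only [inducedAction_inl]
  | inr w => simp only [inducedAction_inr, mul_assoc]
  | mul g h hg hh => rw [inducedAction_mul, hh, hg, inducedAction_mul]

/-- The kernel of `V * W → V × W` maps onto the free group on the pairs of nontrivial elements, by
the action on the orbit `F × {1} × {1}`. -/
theorem exists_surjective_ker_toProd :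
    ∃ θ : (toProd : Monoid.Coprod V W →* V × W).ker →* FreeGroup (NontrivialPairs V W),
      Function.Surjective θ := by
  have hact : ∀ k ∈ (toProd : Monoid.Coprod V W →* V × W).ker,
      inducedAction V W k (1, 1) = ((inducedAction V W k (1, 1)).1, 1) := by
    intro k hk
    refine Prod.ext rfl ?_
    rw [inducedAction_snd, MonoidHom.mem_ker.1 hk, one_mul]
  let θ : (toProd : Monoid.Coprod V W →* V × W).ker →* FreeGroup (NontrivialPairs V W) :=
    MonoidHom.mk' (fun k => (inducedAction V W k.1 (1, 1)).1) (by
      rintro ⟨k, hk⟩ ⟨k', hk'⟩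
      change (inducedAction V W (k * k') (1, 1)).1 = _
      rw [inducedAction_mul, hact k' hk']
      have := inducedAction_mul_right k 1 (inducedAction V W k' (1, 1)).1 1
      rw [one_mul] at this
      rw [this])
  refine ⟨θ, MonoidHom.range_eq_top.1 (eq_top_iff.2 ?_)⟩
  rw [← FreeGroup.closure_range_of, Subgroup.closure_le]
  rintro _ ⟨⟨⟨v, hv⟩, ⟨w, hw⟩⟩, rfl⟩
  -- the commutator of `v` and `w` moves around a square in `V × W`
  have hk : (inr w⁻¹ * inl v⁻¹ * inr w * inl v : Monoid.Coprod V W) ∈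
      (toProd : Monoid.Coprod V W →* V × W).ker := by
    rw [MonoidHom.mem_ker]
    simp [Prod.ext_iff]
  refine ⟨⟨_, hk⟩, ?_⟩
  change (inducedAction V W (inr w⁻¹ * inl v⁻¹ * inr w * inl v) (1, 1)).1 = _
  simp only [inducedAction_mul, inducedAction_inl, inducedAction_inr, Prod.fst_one, Prod.snd_one,
    mul_one, inv_mul_cancel, pairGenerator_one_left, pairGenerator_one_right, inv_one, one_mul]
  simp [pairGenerator, hv, hw]

/-- A group that maps onto the free product of two finite `p`-groups, not both of order two, has a
normal subgroup of `p`-power index that maps onto a non-abelian free group. -/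
theorem exists_normal_surjectsOntoNonabelianFree {G : Type u} [Group G] {p n : ℕ}
    [Nontrivial (NontrivialPairs V W)] (hcard : Nat.card (V × W) = p ^ n)
    (f : G →* Monoid.Coprod V W) (hf : Function.Surjective f) :
    ∃ N : Subgroup G, N.Normal ∧ (∃ k : ℕ, N.index = p ^ k) ∧ SurjectsOntoNonabelianFree N := by
  obtain ⟨θ, hθ⟩ := exists_surjective_ker_toProd (V := V) (W := W)
  refine ⟨(toProd : Monoid.Coprod V W →* V × W).ker.comap f, inferInstance, ⟨n, ?_⟩, ?_⟩
  · rw [Subgroup.index_comap_of_surjective _ hf, Subgroup.index_ker,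
      MonoidHom.range_eq_top.2 toProd_surjective, ← hcard]
    exact Nat.card_congr Subgroup.topEquiv.toEquiv
  · exact ⟨_, inferInstance, θ.comp (f.subgroupComap _),
      hθ.comp (MonoidHom.subgroupComap_surjective_of_surjective _ _ hf)⟩

end FreeProduct

theorem isLargeMod_of_surjective {G : Type u} [Group G] {p : ℕ} [Fact p.Prime]
    (h₁ : ∃ f : G →* Monoid.Coprod (Multiplicative (ZMod p)) (Multiplicative (ZMod p)),
      Function.Surjective f)
    (h₂ : p = 2 → ∃ f : G →* Monoid.Coprod (Multiplicative (ZMod p × ZMod p))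
      (Multiplicative (ZMod p)), Function.Surjective f) : IsLargeMod p G := by
  have hp : p.Prime := Fact.out
  have hN : ∃ N : Subgroup G, N.Normal ∧ (∃ k : ℕ, N.index = p ^ k) ∧
      SurjectsOntoNonabelianFree N := by
    have h10 : Multiplicative.ofAdd (1 : ZMod p) ≠ 1 := by
      rw [← ofAdd_zero, Multiplicative.ofAdd.injective.ne_iff]
      exact one_ne_zero
    by_cases h : p = 2
    · obtain ⟨f, hf⟩ := h₂ h
      have : Nontrivial (NontrivialPairs (Multiplicative (ZMod p × ZMod p))
          (Multiplicative (ZMod p))) := by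
        refine ⟨⟨⟨⟨Multiplicative.ofAdd (1, 0), ?_⟩, ⟨_, h10⟩⟩,
          ⟨⟨Multiplicative.ofAdd (0, 1), ?_⟩, ⟨_, h10⟩⟩, ?_⟩⟩
        · rw [← ofAdd_zero, Multiplicative.ofAdd.injective.ne_iff]
          exact fun h => one_ne_zero (congrArg Prod.fst h)
        · rw [← ofAdd_zero, Multiplicative.ofAdd.injective.ne_iff]
          exact fun h => one_ne_zero (congrArg Prod.snd h)
        · intro h
          have h1 := congrArg (fun q => (Multiplicative.toAdd q.1.1).1) h
          exact one_ne_zero (α := ZMod p) h1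
      refine exists_normal_surjectsOntoNonabelianFree (n := 3) ?_ f hf
      rw [Nat.card_prod, Nat.card_congr Multiplicative.toAdd, Nat.card_prod,
        Nat.card_congr (Multiplicative.toAdd (α := ZMod p)), Nat.card_zmod]
      ring
    · obtain ⟨f, hf⟩ := h₁
      have h2 : (2 : ZMod p) ≠ 0 := by
        intro h2
        have : (2 : ℕ) = p := (Nat.prime_dvd_prime_iff_eq hp Nat.prime_two).1
          ((ZMod.natCast_eq_zero_iff 2 p).1 (by exact_mod_cast h2)) |>.symm
        exact h this.symm
      have : Nontrivial (NontrivialPairs (Multiplicative (ZMod p)) (Multiplicative (ZMod p))) := by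
        refine ⟨⟨⟨⟨Multiplicative.ofAdd 1, h10⟩, ⟨_, h10⟩⟩,
          ⟨⟨Multiplicative.ofAdd 2, ?_⟩, ⟨_, h10⟩⟩, ?_⟩⟩
        · rw [← ofAdd_zero, Multiplicative.ofAdd.injective.ne_iff]
          exact h2
        · intro h
          have h1 : (1 : ZMod p) = 2 := congrArg (fun q => Multiplicative.toAdd q.1.1) h
          exact one_ne_zero (α := ZMod p) (by linear_combination h1.symm)
      refine exists_normal_surjectsOntoNonabelianFree (n := 2) ?_ f hf
      rw [Nat.card_prod, Nat.card_congr Multiplicative.toAdd, Nat.card_zmod]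
      ring
  refine ⟨h₁, hN, ?_⟩
  obtain ⟨N, -, ⟨k, hk⟩, hs⟩ := hN
  exact ⟨N, ⟨by rw [hk]; exact pow_ne_zero _ hp.ne_zero⟩, hs⟩

end LargeGroups

end

/-! ### Values of singular cochains on paths -/

noncomputable section

open scoped Simplicial unitInterval

namespace LargeGroups

section Eval

variable {p : ℕ} {S : SSet.{u}} {n : ℕ}

/-- The value of an `n`-cochain of a simplicial set on an `n`-simplex, as an element of `𝔽_p` rather
than of its lift to another universe. -/
def cochainValue (φ : (S.chainComplex (coeff.{u} p)).X n ⟶ coeff p) (x : S _⦋n⦌) : ZMod p :=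
  ((S.ιChainComplex x ≫ φ).hom ⟨1⟩).down

theorem cochainValue_ext {φ ψ : (S.chainComplex (coeff.{u} p)).X n ⟶ coeff p}
    (h : ∀ x, cochainValue φ x = cochainValue ψ x) : φ = ψ := by
  refine SSet.chainComplex_hom_ext fun x => ModuleCat.hom_ext (LinearMap.ext fun r => ?_)
  have hr : r = r.down • (⟨1⟩ : ULift (ZMod p)) := ULift.ext _ _ (mul_one _).symm
  have h1 : ∀ χ : coeff.{u} p ⟶ coeff p, χ.hom r = r.down • χ.hom ⟨1⟩ := fun χ => by
    rw [← LinearMap.map_smul]; exact congrArg _ hr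
  rw [h1, h1]
  exact congrArg _ (ULift.ext _ _ (h x))

theorem exists_cochainValue_eq (g : S _⦋n⦌ → ZMod p) :
    ∃ φ : (S.chainComplex (coeff.{u} p)).X n ⟶ coeff p, ∀ x, cochainValue φ x = g x := by
  let c := Limits.Cofan.mk (coeff.{u} p) fun x : S _⦋n⦌ =>
    (ModuleCat.ofHom (g x • LinearMap.id) : coeff.{u} p ⟶ coeff p)
  refine ⟨(S.isColimitChainComplexXCofan (coeff.{u} p) n).desc c, fun x => ?_⟩
  have := (S.isColimitChainComplexXCofan (coeff.{u} p) n).fac c ⟨x⟩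
  have h2 : S.ιChainComplex x ≫ (S.isColimitChainComplexXCofan (coeff.{u} p) n).desc c =
      c.ι.app ⟨x⟩ := this
  have h3 := congrArg (fun χ : coeff.{u} p ⟶ coeff p => (χ.hom ⟨1⟩).down) h2
  exact h3.trans (mul_one (g x))

theorem cochainValue_d (φ : (S.chainComplex (coeff.{u} p)).X n ⟶ coeff p) (x : S _⦋n + 1⦌) :
    cochainValue ((S.chainComplex (coeff.{u} p)).d (n + 1) n ≫ φ) x =
      ∑ i : Fin (n + 2), (-1) ^ i.val * cochainValue φ (S.δ i x) := by
  have h : S.ιChainComplex x ≫ (S.chainComplex (coeff.{u} p)).d (n + 1) n ≫ φ =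
      ∑ i : Fin (n + 2), (-1 : ℤ) ^ i.val • (S.ιChainComplex (S.δ i x) ≫ φ) := by
    rw [← Category.assoc, SSet.ιChainComplex_d, Preadditive.sum_comp]
    simp only [Preadditive.zsmul_comp]
  -- evaluation at the generator `1`, as an additive map
  let L : (coeff.{u} p ⟶ coeff p) →+ ZMod p :=
    ⟨⟨fun χ => (χ.hom ⟨1⟩).down, rfl⟩, fun _ _ => rfl⟩
  change L _ = ∑ i : Fin (n + 2), (-1) ^ i.val * L (S.ιChainComplex (S.δ i x) ≫ φ)
  rw [h, map_sum]
  refine Finset.sum_congr rfl fun i _ => ?_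
  rw [map_zsmul, zsmul_eq_mul]
  push_cast
  rfl

theorem cochainValue_map {T : SSet.{u}} (f : S ⟶ T)
    (φ : (T.chainComplex (coeff.{u} p)).X n ⟶ coeff p) (x : S _⦋n⦌) :
    cochainValue ((SSet.chainComplexMap f (coeff.{u} p)).f n ≫ φ) x =
      cochainValue φ (f.app _ x) := by
  rw [cochainValue, ← Category.assoc, SSet.ι_chainComplexMap_f]; rfl

theorem cochainValue_add (φ ψ : (S.chainComplex (coeff.{u} p)).X n ⟶ coeff p) (x : S _⦋n⦌) :
    cochainValue (φ + ψ) x = cochainValue φ x + cochainValue ψ x := by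
  rw [cochainValue, Preadditive.comp_add]; rfl

theorem cochainValue_zero (x : S _⦋n⦌) :
    cochainValue (0 : (S.chainComplex (coeff.{u} p)).X n ⟶ coeff p) x = 0 := by
  rw [cochainValue, Limits.comp_zero]; rfl

theorem cochainValue_smul (s : ZMod p) (φ : (S.chainComplex (coeff.{u} p)).X n ⟶ coeff p)
    (x : S _⦋n⦌) :
    cochainValue (s • φ) x = s * cochainValue φ x := by
  rw [cochainValue, Linear.comp_smul]; rfl

end Eval

section Paths

variable {X : Type u} [TopologicalSpace X] {p : ℕ} {A : Set X}

/-- The singular `n`-cochains of the subspace `A` with coefficients in `𝔽_p`. -/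
abbrev Cochain (p : ℕ) (A : Set X) (n : ℕ) : Type u :=
  ((singularChains.{u} p).obj (TopCat.of A)).X n ⟶ coeff p

/-- A point, as a singular `0`-simplex. -/
def pointSimplex (a : A) : (TopCat.toSSet.obj (TopCat.of A)) _⦋0⦌ :=
  ((TopCat.of A).toSSetObjEquiv (Opposite.op ⦋0⦌)).symm (ContinuousMap.const _ a)

/-- A path, as a singular `1`-simplex; the parameter is the second barycentric coordinate. -/
def pathSimplex (γ : C(I, A)) : (TopCat.toSSet.obj (TopCat.of A)) _⦋1⦌ :=
  ((TopCat.of A).toSSetObjEquiv (Opposite.op ⦋1⦌)).symm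
    (γ.comp (stdSimplexHomeomorphUnitInterval : C(stdSimplex ℝ (Fin 2), I)))

/-- The singular `2`-simplex that a map of the plane defines on the triangle with vertices `v`. -/
def triangleSimplex (f : C(ℝ × ℝ, A)) (v : Fin 3 → ℝ × ℝ) :
    (TopCat.toSSet.obj (TopCat.of A)) _⦋2⦌ :=
  ((TopCat.of A).toSSetObjEquiv (Opposite.op ⦋2⦌)).symm
    (f.comp ⟨fun x : stdSimplex ℝ (Fin 3) => ∑ j, x.1 j • v j, continuous_finsetSum _ fun j _ =>
      ((continuous_apply j).comp continuous_subtype_val).smul continuous_const⟩)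

theorem exists_pathSimplex_eq (s : (TopCat.toSSet.obj (TopCat.of A)) _⦋1⦌) :
    ∃ γ : C(I, A), pathSimplex γ = s := by
  let g : C(stdSimplex ℝ (Fin 2), A) := (TopCat.of A).toSSetObjEquiv (Opposite.op ⦋1⦌) s
  refine ⟨g.comp (stdSimplexHomeomorphUnitInterval.symm : C(I, stdSimplex ℝ (Fin 2))), ?_⟩
  refine ((TopCat.of A).toSSetObjEquiv (Opposite.op ⦋1⦌)).injective ?_
  rw [pathSimplex, Equiv.apply_symm_apply]
  ext x
  simp [g]

theorem stdSimplex_map_succAbove_self {n : ℕ} (i : Fin (n + 1)) (x : stdSimplex ℝ (Fin n)) :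
    stdSimplex.map i.succAbove x i = 0 := by
  rw [stdSimplex.map_coe, FunOnFinite.linearMap_apply_apply]
  exact Finset.sum_eq_zero fun j hj => absurd (Finset.mem_filter.1 hj).2 (Fin.succAbove_ne i j)

theorem stdSimplex_map_succAbove {n : ℕ} (i : Fin (n + 1)) (x : stdSimplex ℝ (Fin n)) (j : Fin n) :
    stdSimplex.map i.succAbove x (i.succAbove j) = x j := by
  rw [stdSimplex.map_coe, FunOnFinite.linearMap_apply_apply]
  simp [Finset.filter_eq']

theorem δ_zero_pathSimplex (γ : C(I, A)) :
    (TopCat.toSSet.obj (TopCat.of A)).δ 0 (pathSimplex γ) = pointSimplex (γ 1) := by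
  refine (TopCat.toSSetObjEquiv_symm_naturality _ _).trans (congrArg _ ?_)
  ext x
  refine congrArg (fun t => (γ t : X)) (Subtype.ext ?_)
  refine (stdSimplex_map_succAbove (0 : Fin 2) x 0).trans ?_
  simp

theorem δ_one_pathSimplex (γ : C(I, A)) :
    (TopCat.toSSet.obj (TopCat.of A)).δ 1 (pathSimplex γ) = pointSimplex (γ 0) := by
  refine (TopCat.toSSetObjEquiv_symm_naturality _ _).trans (congrArg _ ?_)
  ext x
  exact congrArg (fun t => (γ t : X)) (Subtype.ext (stdSimplex_map_succAbove_self (1 : Fin 2) x))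

theorem δ_triangleSimplex (f : C(ℝ × ℝ, A)) (v : Fin 3 → ℝ × ℝ) (i : Fin 3) :
    (TopCat.toSSet.obj (TopCat.of A)).δ i (triangleSimplex f v) =
      pathSimplex (segmentPath f (v (i.succAbove 0)) (v (i.succAbove 1))) := by
  refine (TopCat.toSSetObjEquiv_symm_naturality _ _).trans (congrArg _ ?_)
  ext x
  refine congrArg (fun t => (f t : X)) ?_
  have h1 : ∑ j, stdSimplex.map i.succAbove x j • v j = ∑ j, x j • v (i.succAbove j) := by
    rw [Fin.sum_univ_succAbove _ i, stdSimplex_map_succAbove_self, zero_smul, zero_add]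
    simp only [stdSimplex_map_succAbove]
  refine h1.trans ?_
  have h2 : x 0 = 1 - x 1 := by
    have := x.2.2
    rw [Fin.sum_univ_two] at this
    exact eq_sub_of_add_eq this
  rw [Fin.sum_univ_two, h2]
  exact (AffineMap.lineMap_apply_module _ _ _).symm

open Classical in
/-- The value of a singular `1`-cochain of `A` on a path of `X`; it is `0` if the path is not
contained in `A`. -/
def pathValue (φ : Cochain p A 1) (γ : C(I, X)) : ZMod p :=
  if h : ∀ t, γ t ∈ A then
    cochainValue (S := TopCat.toSSet.obj (TopCat.of A)) φ
      (pathSimplex ⟨fun t => ⟨γ t, h t⟩, by fun_prop⟩)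
  else 0

theorem pathValue_coe (φ : Cochain p A 1) (γ : C(I, A)) :
    pathValue φ (ContinuousMap.comp ⟨Subtype.val, continuous_subtype_val⟩ γ) =
      cochainValue (S := TopCat.toSSet.obj (TopCat.of A)) φ (pathSimplex γ) :=
  dif_pos fun t => (γ t).2

theorem exists_coe_comp_eq {Y : Type*} [TopologicalSpace Y] (γ : C(Y, X)) (h : ∀ t, γ t ∈ A) :
    ∃ γ' : C(Y, A), γ = ContinuousMap.comp ⟨Subtype.val, continuous_subtype_val⟩ γ' :=
  ⟨⟨fun t => ⟨γ t, h t⟩, by fun_prop⟩, rfl⟩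

theorem pathValue_add (φ ψ : Cochain p A 1) (γ : C(I, X)) :
    pathValue (φ + ψ) γ = pathValue φ γ + pathValue ψ γ := by
  unfold pathValue
  split_ifs
  · exact cochainValue_add _ _ _
  · exact (add_zero 0).symm

theorem pathValue_smul (s : ZMod p) (φ : Cochain p A 1) (γ : C(I, X)) :
    pathValue (s • φ) γ = s * pathValue φ γ := by
  unfold pathValue
  split_ifs
  · exact cochainValue_smul _ _ _
  · exact (mul_zero s).symm

/-- The coboundary of a singular cochain (without a sign). -/
def coboundary {n : ℕ} (φ : Cochain p A n) : Cochain p A (n + 1) :=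
  ((singularChains.{u} p).obj (TopCat.of A)).d (n + 1) n ≫ φ

theorem isAddPathCocycle_pathValue {φ : Cochain p A 1} (hφ : coboundary φ = 0) :
    IsAddPathCocycle A (pathValue φ) := by
  intro f hf u v w
  obtain ⟨f, rfl⟩ := exists_coe_comp_eq f hf
  -- the cocycle condition on the triangle `u v w`
  have h := cochainValue_d (S := TopCat.toSSet.obj (TopCat.of A)) φ (triangleSimplex f ![u, v, w])
  have h0 : cochainValue (S := TopCat.toSSet.obj (TopCat.of A)) (coboundary φ)
      (triangleSimplex f ![u, v, w]) = 0 := by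
    rw [hφ]; exact cochainValue_zero _
  replace h := h.symm.trans h0
  simp only [δ_triangleSimplex] at h
  have hs : ∀ u v, segmentPath (ContinuousMap.comp ⟨Subtype.val, continuous_subtype_val⟩ f) u v =
      ContinuousMap.comp ⟨(Subtype.val : A → X), continuous_subtype_val⟩ (segmentPath f u v) :=
    fun _ _ => rfl
  simp only [hs, pathValue_coe]
  rw [← ofAdd_add]
  congr 1
  rw [Fin.sum_univ_three] at h
  simp [Fin.succAbove] at h
  linear_combination h

/-- A `1`-cocycle that vanishes on loops is a coboundary. -/
theorem exists_coboundary_eq {φ : Cochain p A 1} (hφ : coboundary φ = 0)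
    (h : ∀ (x : X) (γ : Path x x), (∀ t, γ t ∈ A) → pathValue φ γ = 0) :
    ∃ ψ : Cochain p A 0, coboundary ψ = φ := by
  obtain ⟨g, hg⟩ := (isAddPathCocycle_pathValue hφ).exists_primitive h
  obtain ⟨ψ, hψ⟩ := exists_cochainValue_eq (p := p) (S := TopCat.toSSet.obj (TopCat.of A)) (n := 0)
    fun s => g (((TopCat.of A).toSSetObjEquiv (Opposite.op ⦋0⦌) s default : A) : X)
  refine ⟨ψ, cochainValue_ext (S := TopCat.toSSet.obj (TopCat.of A)) fun s => ?_⟩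
  obtain ⟨γ, rfl⟩ := exists_pathSimplex_eq s
  refine (cochainValue_d _ _).trans ?_
  rw [← pathValue_coe, hg _ fun t => (γ t).2, Fin.sum_univ_two, δ_zero_pathSimplex,
    δ_one_pathSimplex, hψ, hψ]
  simp [pointSimplex, sub_eq_add_neg]

theorem pathValue_coboundary (ψ : Cochain p A 0) {x : X} (γ : Path x x) :
    pathValue (coboundary ψ) γ = 0 := by
  by_cases h : ∀ t, γ t ∈ A
  · obtain ⟨γ', hγ⟩ := exists_coe_comp_eq (γ : C(I, X)) h
    rw [hγ, pathValue_coe]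
    refine (cochainValue_d _ _).trans ?_
    have h01 : γ' 0 = γ' 1 := Subtype.ext <| by
      have h0 := congrArg (fun f => f 0) hγ
      have h1 := congrArg (fun f => f 1) hγ
      exact h0.symm.trans (γ.source.trans (γ.target.symm.trans h1))
    rw [Fin.sum_univ_two, δ_zero_pathSimplex, δ_one_pathSimplex, h01]
    simp
  · exact dif_neg h

/-- The restriction of a singular cochain to a smaller subspace. -/
def restrictCochain {D : Set X} (h : D ⊆ A) {n : ℕ} (φ : Cochain p A n) : Cochain p D n :=
  ((singularChains.{u} p).map
    (TopCat.ofHom (⟨Set.inclusion h, continuous_inclusion h⟩ : C(D, A)))).f n ≫ φ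

theorem pathValue_restrictCochain {D : Set X} (h : D ⊆ A) (φ : Cochain p A 1) {γ : C(I, X)}
    (hγ : ∀ t, γ t ∈ D) : pathValue (restrictCochain h φ) γ = pathValue φ γ := by
  rw [pathValue, dif_pos hγ, pathValue, dif_pos fun t => h (hγ t)]
  exact cochainValue_map (TopCat.toSSet.map
    (TopCat.ofHom (⟨Set.inclusion h, continuous_inclusion h⟩ : C(D, A)))) φ _

end Paths
end LargeGroups

end

/-! ### Relative cocycles from cohomology and homology -/

noncomputable section

open scoped unitInterval

namespace LargeGroups

section Complex

variable {R : Type*} [Ring R] {ι : Type*} {c : ComplexShape ι}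
  {K L : HomologicalComplex (ModuleCat.{u} R) c} {i j : ι}

/-- The element `x` of `K_i` is a cycle representing the homology class `ξ`. -/
def Represents (K : HomologicalComplex (ModuleCat.{u} R) c) (i : ι) (x : K.X i) (ξ : K.homology i) :
    Prop :=
  ∃ z : K.cycles i, (K.iCycles i).hom z = x ∧ (K.homologyπ i).hom z = ξ

namespace Represents

variable {x y : K.X i} {ξ η : K.homology i}

theorem d_eq_zero (h : Represents K i x ξ) (j : ι) : (K.d i j).hom x = 0 := by
  obtain ⟨z, rfl, -⟩ := h
  have := K.iCycles_d i j
  exact congrArg (fun f => f.hom z) this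

theorem smul_add_smul (h : Represents K i x ξ) (h' : Represents K i y η) (s t : R) :
    Represents K i (s • x + t • y) (s • ξ + t • η) := by
  obtain ⟨z, rfl, rfl⟩ := h
  obtain ⟨w, rfl, rfl⟩ := h'
  exact ⟨s • z + t • w, by simp, by simp⟩

theorem map (h : Represents K i x ξ) (f : K ⟶ L) :
    Represents L i ((f.f i).hom x) ((HomologicalComplex.homologyMap f i).hom ξ) := by
  obtain ⟨z, rfl, rfl⟩ := h
  refine ⟨(HomologicalComplex.cyclesMap f i).hom z, ?_, ?_⟩
  · exact congrArg (fun f => f.hom z) (HomologicalComplex.cyclesMap_i f i)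
  · exact congrArg (fun f => f.hom z) (HomologicalComplex.homologyπ_naturality f i).symm

theorem eq_zero_of_boundary {y : K.X j} (h : Represents K i ((K.d j i).hom y) ξ) : ξ = 0 := by
  obtain ⟨z, hz, rfl⟩ := h
  have h1 : z = (K.toCycles j i).hom y := by
    refine (ModuleCat.mono_iff_injective (K.iCycles i)).1 inferInstance ?_
    refine hz.trans ?_
    exact (congrArg (fun f => f.hom y) (K.toCycles_i j i)).symm
  rw [h1]
  exact congrArg (fun f => f.hom y) (K.toCycles_comp_homologyπ j i)

theorem exists_boundary (hji : c.prev i = j) (h : Represents K i x (0 : K.homology i)) :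
    ∃ y, (K.d j i).hom y = x := by
  obtain ⟨z, rfl, hz⟩ := h
  have hex : (ShortComplex.mk (K.toCycles j i) (K.homologyπ i)
      (K.toCycles_comp_homologyπ j i)).Exact :=
    ShortComplex.exact_of_g_is_cokernel _ (K.homologyIsCokernel j i hji)
  obtain ⟨y, hy⟩ := (ShortComplex.moduleCat_exact_iff _).1 hex z hz
  refine ⟨y, ?_⟩
  rw [← K.toCycles_i j i, ModuleCat.comp_apply]
  exact congrArg _ hy

end Represents

theorem exists_represents (ξ : K.homology i) : ∃ x, Represents K i x ξ := by
  obtain ⟨z, rfl⟩ := (ModuleCat.epi_iff_surjective (K.homologyπ i)).1 inferInstance ξ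
  exact ⟨_, z, rfl, rfl⟩

theorem exists_iCycles_eq (hij : c.next i = j) {x : K.X i} (hx : (K.d i j).hom x = 0) :
    ∃ z, (K.iCycles i).hom z = x := by
  have hex : (ShortComplex.mk (K.iCycles i) (K.d i j) (K.iCycles_d i j)).Exact :=
    ShortComplex.exact_of_f_is_kernel _ (K.cyclesIsKernel i j hij)
  exact (ShortComplex.moduleCat_exact_iff _).1 hex x hx

end Complex

section Field

variable {F : Type*} [Field F] {ι : Type*} {c : ComplexShape ι}
  {K L : HomologicalComplex (ModuleCat.{u} F) c} {i j : ι} {M : ModuleCat.{u} F}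

/-- A linear form on homology is induced by a linear form on the chains. -/
theorem exists_iCycles_comp_eq (f : K.homology i ⟶ M) :
    ∃ φ : K.X i ⟶ M, K.iCycles i ≫ φ = K.homologyπ i ≫ f := by
  obtain ⟨g, hg⟩ := (K.iCycles i).hom.exists_leftInverse_of_injective
    (LinearMap.ker_eq_bot.2 ((ModuleCat.mono_iff_injective (K.iCycles i)).1 inferInstance))
  refine ⟨ModuleCat.ofHom g ≫ K.homologyπ i ≫ f, ?_⟩
  have : K.iCycles i ≫ ModuleCat.ofHom g = 𝟙 _ := ModuleCat.hom_ext hg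
  rw [← Category.assoc, this, Category.id_comp]

theorem d_comp_eq_zero {f : K.homology i ⟶ M} {φ : K.X i ⟶ M}
    (h : K.iCycles i ≫ φ = K.homologyπ i ≫ f) (j : ι) : K.d j i ≫ φ = 0 := by
  rw [← K.toCycles_i j i, Category.assoc, h, ← Category.assoc, K.toCycles_comp_homologyπ,
    Limits.zero_comp]

theorem eq_zero_of_d_comp {f : K.homology i ⟶ M} {ψ : K.X j ⟶ M}
    (h : K.iCycles i ≫ K.d i j ≫ ψ = K.homologyπ i ≫ f) : f = 0 := by
  rw [← Category.assoc, K.iCycles_d, Limits.zero_comp] at h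
  rw [← cancel_epi (K.homologyπ i), ← h, Limits.comp_zero]

/-- Over a field, a linear form on chains that vanishes on the cycles is a coboundary. -/
theorem exists_d_comp_eq (hij : c.next i = j) {χ : K.X i ⟶ M} (h : K.iCycles i ≫ χ = 0) :
    ∃ ψ : K.X j ⟶ M, K.d i j ≫ ψ = χ := by
  have hker : LinearMap.ker (K.d i j).hom ≤ LinearMap.ker χ.hom := by
    intro x hx
    obtain ⟨z, rfl⟩ := exists_iCycles_eq hij hx
    exact congrArg (fun f => f.hom z) h
  obtain ⟨g, hg⟩ := ((LinearMap.ker (K.d i j).hom).liftQ χ.hom hker ∘ₗ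
    (K.d i j).hom.quotKerEquivRange.symm.toLinearMap).exists_extend
  refine ⟨ModuleCat.ofHom g, ModuleCat.hom_ext (LinearMap.ext fun x => ?_)⟩
  have := LinearMap.congr_fun hg ⟨(K.d i j).hom x, x, rfl⟩
  refine this.trans ?_
  simp only [LinearMap.comp_apply, LinearEquiv.coe_coe]
  have h2 : (K.d i j).hom.quotKerEquivRange.symm ⟨(K.d i j).hom x, x, rfl⟩ =
    Submodule.Quotient.mk x := by
    rw [LinearEquiv.symm_apply_eq]; rfl
  rw [h2]; rfl

theorem iCycles_comp_f_comp_eq_zero (g : L ⟶ K) {f : K.homology i ⟶ M} {φ : K.X i ⟶ M}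
    (h : K.iCycles i ≫ φ = K.homologyπ i ≫ f)
    (h0 : HomologicalComplex.homologyMap g i ≫ f = 0) :
    L.iCycles i ≫ g.f i ≫ φ = 0 := by
  rw [← Category.assoc, ← HomologicalComplex.cyclesMap_i, Category.assoc, h, ← Category.assoc,
    ← HomologicalComplex.homologyπ_naturality, Category.assoc, h0, Limits.comp_zero]

end Field

section Cocycles

variable {X : Type u} [TopologicalSpace X] {p : ℕ} {A D : Set X}

/-- A singular `1`-cocycle of `A` whose restriction to `D` is a coboundary. -/
def IsRelativeCocycle (h : D ⊆ A) (φ : Cochain p A 1) : Prop :=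
  coboundary φ = 0 ∧ ∃ ψ : Cochain p D 0, coboundary ψ = restrictCochain h φ

theorem IsRelativeCocycle.pathValue_eq_zero {h : D ⊆ A} {φ : Cochain p A 1}
    (hφ : IsRelativeCocycle h φ) {x : X} (γ : Path x x) (hγ : ∀ t, γ t ∈ D) :
    pathValue φ γ = 0 := by
  obtain ⟨-, ψ, hψ⟩ := hφ
  refine (pathValue_restrictCochain h φ (γ := (γ : C(I, X))) hγ).symm.trans ?_
  rw [← hψ]
  exact pathValue_coboundary ψ γ

theorem exists_loop_pathValue_ne_zero {φ : Cochain p A 1} (hφ : coboundary φ = 0)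
    (h : ∀ ψ, coboundary ψ ≠ φ) : ∃ (x : X) (γ : Path x x), (∀ t, γ t ∈ A) ∧ pathValue φ γ ≠ 0 := by
  by_contra! hc
  obtain ⟨ψ, hψ⟩ := exists_coboundary_eq hφ hc
  exact h ψ hψ

theorem IsRelativeCocycle.exists_isFullLabelling [Fact p.Prime] {B : Set X} (hB : A ∩ B ⊆ D)
    {hD : D ⊆ A} {φ : Cochain p A 1} (hφ : IsRelativeCocycle hD φ) (h : ∀ ψ, coboundary ψ ≠ φ) :
    ∃ c : C(I, X) → ZMod p, IsFullLabelling A B c :=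
  LargeGroups.exists_isFullLabelling (isAddPathCocycle_pathValue hφ.1)
    (fun _ γ hγ => hφ.pathValue_eq_zero γ fun t => hB (hγ t)) (exists_loop_pathValue_ne_zero hφ.1 h)

theorem coboundary_smul_add_smul (s t : ZMod p) {n : ℕ} (φ ψ : Cochain p A n) :
    coboundary (s • φ + t • ψ) = s • coboundary φ + t • coboundary ψ := by
  simp only [coboundary, Preadditive.comp_add, Linear.comp_smul]

theorem IsRelativeCocycle.exists_isFullLabelling_prod [Fact p.Prime] {B : Set X}
    (hB : A ∩ B ⊆ D) {hD : D ⊆ A} {φ₁ φ₂ : Cochain p A 1}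
    (h₁ : IsRelativeCocycle hD φ₁) (h₂ : IsRelativeCocycle hD φ₂)
    (h : ∀ s t : ZMod p, (s, t) ≠ (0, 0) → ∀ ψ, coboundary ψ ≠ s • φ₁ + t • φ₂) :
    ∃ c : C(I, X) → ZMod p × ZMod p, IsFullLabelling A B c := by
  refine LargeGroups.exists_isFullLabelling_prod (isAddPathCocycle_pathValue h₁.1)
    (isAddPathCocycle_pathValue h₂.1) (fun _ γ hγ => h₁.pathValue_eq_zero γ fun t => hB (hγ t))
    (fun _ γ hγ => h₂.pathValue_eq_zero γ fun t => hB (hγ t)) fun s t hst => ?_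
  have hd : coboundary (s • φ₁ + t • φ₂) = 0 := by
    rw [coboundary_smul_add_smul, h₁.1, h₂.1, smul_zero, smul_zero, add_zero]
  obtain ⟨x, γ, hγ, hne⟩ := exists_loop_pathValue_ne_zero hd (h s t hst)
  refine ⟨x, γ, hγ, ?_⟩
  rwa [pathValue_add, pathValue_smul, pathValue_smul] at hne

/-- A class in the kernel of `H¹(A) → H¹(D)` is represented by a relative cocycle. -/
theorem exists_relativeCocycle_of_cohomology (h : D ⊆ A) (ξ : H1 p A) (hξ : restrict p h ξ = 0) :
    ∃ φ : Cochain p A 1, IsRelativeCocycle h φ ∧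
      Represents ((singularCochains.{u} p).obj (Opposite.op (TopCat.of A))) 1 φ ξ := by
  obtain ⟨φ, hφ⟩ := exists_represents ξ
  refine ⟨φ, ⟨hφ.d_eq_zero 2, ?_⟩, hφ⟩
  have h1 := hφ.map ((singularCochains.{u} p).map
    (TopCat.ofHom (⟨Set.inclusion h, continuous_inclusion h⟩ : C(D, A))).op)
  change Represents _ _ _ (restrict p h ξ) at h1
  rw [hξ] at h1
  obtain ⟨ψ, hψ⟩ := h1.exists_boundary (j := 0) (by simp)
  exact ⟨ψ, hψ⟩

theorem coboundary_ne_of_represents {φ : Cochain p A 1} {ξ : H1 p A}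
    (h : Represents ((singularCochains.{u} p).obj (Opposite.op (TopCat.of A))) 1 φ ξ) (hξ : ξ ≠ 0)
    (ψ : Cochain p A 0) : coboundary ψ ≠ φ := by
  rintro rfl
  exact hξ (h.eq_zero_of_boundary (j := 0) (y := ψ))

/-- The map `H₁(D; 𝔽_p) → H₁(A; 𝔽_p)` induced by an inclusion `D ⊆ A`. -/
def homologyMap (p : ℕ) (h : D ⊆ A) : H₁ p D ⟶ H₁ p A :=
  ((AlgebraicTopology.singularHomologyFunctor (ModuleCat.{u} (ZMod p)) 1).obj (coeff.{u} p)).map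
    (TopCat.ofHom (⟨Set.inclusion h, continuous_inclusion h⟩ : C(D, A)))

/-- A linear form on `H₁(A)` that vanishes on the image of `H₁(D)` is induced by a relative
cocycle. -/
theorem exists_relativeCocycle_of_homology [Fact p.Prime] (h : D ⊆ A) (f : H₁ p A ⟶ coeff p)
    (hf : homologyMap p h ≫ f = 0) :
    ∃ φ : Cochain p A 1, IsRelativeCocycle h φ ∧
      ((singularChains.{u} p).obj (TopCat.of A)).iCycles 1 ≫ φ =
        ((singularChains.{u} p).obj (TopCat.of A)).homologyπ 1 ≫ f := by
  obtain ⟨φ, hφ⟩ := exists_iCycles_comp_eq (K := (singularChains.{u} p).obj (TopCat.of A)) f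
  refine ⟨φ, ⟨d_comp_eq_zero hφ 2, ?_⟩, hφ⟩
  exact exists_d_comp_eq (by simp) (iCycles_comp_f_comp_eq_zero ((singularChains.{u} p).map
    (TopCat.ofHom (⟨Set.inclusion h, continuous_inclusion h⟩ : C(D, A)))) hφ hf)

end Cocycles
end LargeGroups

end

/-! ### Linear algebra over finite fields -/

noncomputable section

namespace LargeGroups

section LinearAlgebra

variable {F : Type*} [Field F] {V W : Type*} [AddCommGroup V] [Module F V] [AddCommGroup W]
  [Module F W]

theorem exists_pair_smul_add_smul_ne_zero (h : 1 < Module.rank F V) :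
    ∃ v w : V, ∀ s t : F, (s, t) ≠ (0, 0) → s • v + t • w ≠ 0 := by
  have : Nontrivial V := rank_pos_iff_nontrivial.1 (zero_lt_one.trans h)
  obtain ⟨v, hv⟩ := exists_ne (0 : V)
  obtain ⟨w, hw⟩ := exists_linearIndependent_pair_of_one_lt_rank h hv
  refine ⟨v, w, fun s t hst h0 => hst ?_⟩
  obtain ⟨rfl, rfl⟩ := LinearIndependent.pair_iff.1 hw s t h0
  rfl

theorem exists_ker_pair_smul_add_smul_ne_zero (T : V →ₗ[F] W)
    (h : 1 < Module.rank F (LinearMap.ker T)) :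
    ∃ v w : V, T v = 0 ∧ T w = 0 ∧ ∀ s t : F, (s, t) ≠ (0, 0) → s • v + t • w ≠ 0 := by
  obtain ⟨v, w, hvw⟩ := exists_pair_smul_add_smul_ne_zero h
  exact ⟨v, w, v.2, w.2, fun s t hst h0 => hvw s t hst (Subtype.ext h0)⟩

theorem exists_dual_pair_smul_add_smul_ne_zero (h : 1 < Module.rank F V) :
    ∃ f g : V →ₗ[F] F, ∀ s t : F, (s, t) ≠ (0, 0) → s • f + t • g ≠ 0 := by
  obtain ⟨v, w, hvw⟩ := exists_pair_smul_add_smul_ne_zero h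
  let e : F × F →ₗ[F] V :=
    (LinearMap.toSpanSingleton F V v).coprod (LinearMap.toSpanSingleton F V w)
  obtain ⟨g, hg⟩ := e.exists_leftInverse_of_injective (LinearMap.ker_eq_bot'.2 fun q hq => by
    by_contra hne
    exact hvw q.1 q.2 hne hq)
  refine ⟨LinearMap.fst F F F ∘ₗ g, LinearMap.snd F F F ∘ₗ g, fun s t hst h0 => hst ?_⟩
  have h1 : ∀ q : F × F, s * q.1 + t * q.2 = 0 := fun q => by
    have h2 := LinearMap.congr_fun h0 (e q)
    have h3 : g (e q) = q := LinearMap.congr_fun hg q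
    simpa [h3] using h2
  have hs := h1 (1, 0)
  have ht := h1 (0, 1)
  simp at hs ht
  rw [hs, ht]

theorem card_le_card_mul_card_quotient (T : W →ₗ[F] V) :
    ENat.card V ≤ ENat.card (V ⧸ LinearMap.range T) * ENat.card W := by
  rw [ENat.card_congr (AddSubgroup.addGroupEquivQuotientProdAddSubgroup
    (s := (LinearMap.range T).toAddSubgroup)), ENat.card_prod]
  have h : ENat.card (LinearMap.range T).toAddSubgroup ≤ ENat.card W :=
    ENat.card_le_card_of_injective (f := fun v : (LinearMap.range T).toAddSubgroup => v.2.choose)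
      fun v w hvw => Subtype.ext (by
        rw [← v.2.choose_spec, ← w.2.choose_spec]; exact congrArg T hvw)
  exact mul_le_mul' le_rfl h

/-- If `V` has more elements than `W`, the map `T` is not onto, so a nonzero linear form kills its
range. -/
theorem exists_dual_ne_zero (T : W →ₗ[F] V) (h : ENat.card W < ENat.card V) :
    ∃ f : V →ₗ[F] F, f ≠ 0 ∧ f ∘ₗ T = 0 := by
  have hne : LinearMap.range T ≠ ⊤ := by
    intro ht
    have : Subsingleton (V ⧸ LinearMap.range T) := by
      rw [ht]; infer_instance
    have h1 := card_le_card_mul_card_quotient T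
    have h2 : ENat.card (V ⧸ LinearMap.range T) ≤ 1 := (ENat.card_le_one_iff_subsingleton _).2 this
    exact h.not_ge (h1.trans ((mul_le_mul' h2 le_rfl).trans_eq (one_mul _)))
  obtain ⟨f, hf, hle⟩ := Submodule.exists_le_ker_of_lt_top _ (lt_top_iff_ne_top.2 hne)
  exact ⟨f, hf, LinearMap.ext fun w => hle ⟨w, rfl⟩⟩

/-- If `V` has more than `|F| |W|` elements, the cokernel of `T` has dimension at least two. -/
theorem exists_dual_pair (T : W →ₗ[F] V) (h : ENat.card F * ENat.card W < ENat.card V) :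
    ∃ f g : V →ₗ[F] F, f ∘ₗ T = 0 ∧ g ∘ₗ T = 0 ∧
      ∀ s t : F, (s, t) ≠ (0, 0) → s • f + t • g ≠ 0 := by
  have hrank : 1 < Module.rank F (V ⧸ LinearMap.range T) := by
    by_contra! hle
    obtain ⟨q, hq⟩ := rank_le_one_iff.1 hle
    choose r hr using hq
    have h1 : ENat.card (V ⧸ LinearMap.range T) ≤ ENat.card F :=
      ENat.card_le_card_of_injective (f := r) fun a b hab => by rw [← hr a, ← hr b, hab]
    exact h.not_ge ((card_le_card_mul_card_quotient T).trans (mul_le_mul' h1 le_rfl))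
  obtain ⟨f, g, hfg⟩ := exists_dual_pair_smul_add_smul_ne_zero hrank
  have hT : ∀ k : (V ⧸ LinearMap.range T) →ₗ[F] F, (k ∘ₗ (LinearMap.range T).mkQ) ∘ₗ T = 0 :=
    fun k => by rw [LinearMap.comp_assoc, LinearMap.range_mkQ_comp, LinearMap.comp_zero]
  refine ⟨f ∘ₗ (LinearMap.range T).mkQ, g ∘ₗ (LinearMap.range T).mkQ, hT f, hT g,
    fun s t hst h0 => hfg s t hst (Submodule.linearMap_qext _ ?_)⟩
  exact h0

end LinearAlgebra

theorem iCycles_comp_smul_add_smul {F : Type*} [Field F] {ι : Type*} {c : ComplexShape ι}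
    {K : HomologicalComplex (ModuleCat.{u} F) c} {i : ι} {M : ModuleCat.{u} F}
    {f g : K.homology i ⟶ M} {φ ψ : K.X i ⟶ M} (hφ : K.iCycles i ≫ φ = K.homologyπ i ≫ f)
    (hψ : K.iCycles i ≫ ψ = K.homologyπ i ≫ g) (s t : F) :
    K.iCycles i ≫ (s • φ + t • ψ) = K.homologyπ i ≫ (s • f + t • g) := by
  simp only [Preadditive.comp_add, Linear.comp_smul, hφ, hψ]

/-! ### Decompositions of a finite CW complex -/

section Complexes

variable {X : Type u} [TopologicalSpace X]

/-- The intersection of two subcomplexes is a subcomplex, hence locally contractible. -/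
theorem isLocallyContractible_subcomplex_inter [T2Space X]
    [Topology.CWComplex (Set.univ : Set X)] [Topology.CWComplex.Finite (Set.univ : Set X)]
    (A B : Topology.CWComplex.Subcomplex (Set.univ : Set X)) :
    IsLocallyContractible ((A : Set X) ∩ B) := by
  let E : Topology.CWComplex.Subcomplex (Set.univ : Set X) :=
    { carrier := (A : Set X) ∩ B
      I := fun n => A.I n ∩ B.I n
      closed' := A.closed.inter B.closed
      union' := by
        rw [Set.empty_union]
        refine Set.Subset.antisymm (Set.iUnion₂_subset fun n j => Set.subset_inter ?_ ?_) ?_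
        · exact A.openCell_subset_of_mem j.2.1
        · exact B.openCell_subset_of_mem j.2.2
        · rintro x ⟨hA, hB⟩
          rw [← A.union, Set.empty_union] at hA
          obtain ⟨n, j, hj⟩ := Set.mem_iUnion₂.1 hA
          refine Set.mem_iUnion₂.2 ⟨n, ⟨j, j.2, ?_⟩, hj⟩
          by_contra hn
          exact (B.disjoint_openCell_subcomplex_of_not_mem hn).notMem_of_mem_left hj hB }
  exact isLocallyContractible_of_finite (E : Set X)

variable {p : ℕ} {A B D : Set X}

/-- Some relative cocycle is not a coboundary on `A`, that is, `H¹(A) → H¹(D)` is not injective. -/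
def HasRelativeClass (p : ℕ) (h : D ⊆ A) : Prop :=
  ∃ φ : Cochain p A 1, IsRelativeCocycle h φ ∧ ∀ ψ, coboundary ψ ≠ φ

/-- Two relative cocycles are linearly independent modulo the coboundaries on `A`, that is, the
kernel of `H¹(A) → H¹(D)` has dimension at least two. -/
def HasRelativeClassPair (p : ℕ) (h : D ⊆ A) : Prop :=
  ∃ φ₁ φ₂ : Cochain p A 1, IsRelativeCocycle h φ₁ ∧ IsRelativeCocycle h φ₂ ∧
    ∀ s t : ZMod p, (s, t) ≠ (0, 0) → ∀ ψ, coboundary ψ ≠ s • φ₁ + t • φ₂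

theorem hasRelativeClass_of_not_injective (h : D ⊆ A) (hi : ¬ Function.Injective (restrict p h)) :
    HasRelativeClass p h := by
  rw [← LinearMap.ker_eq_bot, Submodule.eq_bot_iff] at hi
  push Not at hi
  obtain ⟨ξ, hξ, hne⟩ := hi
  obtain ⟨φ, hφ, hr⟩ := exists_relativeCocycle_of_cohomology h ξ hξ
  exact ⟨φ, hφ, coboundary_ne_of_represents hr hne⟩

theorem represents_smul_add_smul {ξ η : H1 p A} {φ₁ φ₂ : Cochain p A 1}
    (h₁ : Represents ((singularCochains.{u} p).obj (Opposite.op (TopCat.of A))) 1 φ₁ ξ)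
    (h₂ : Represents ((singularCochains.{u} p).obj (Opposite.op (TopCat.of A))) 1 φ₂ η)
    (s t : ZMod p) :
    Represents ((singularCochains.{u} p).obj (Opposite.op (TopCat.of A))) 1
      (s • φ₁ + t • φ₂ : Cochain p A 1) (s • ξ + t • η : H1 p A) :=
  h₁.smul_add_smul h₂ s t

theorem hasRelativeClassPair_of_rank [Fact p.Prime] (h : D ⊆ A)
    (hi : 1 < Module.rank (ZMod p) (LinearMap.ker (restrict p h))) : HasRelativeClassPair p h := by
  obtain ⟨ξ, η, hξ, hη, hne⟩ := exists_ker_pair_smul_add_smul_ne_zero (restrict p h) hi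
  obtain ⟨φ₁, hφ₁, hr₁⟩ := exists_relativeCocycle_of_cohomology h ξ hξ
  obtain ⟨φ₂, hφ₂, hr₂⟩ := exists_relativeCocycle_of_cohomology h η hη
  exact ⟨φ₁, φ₂, hφ₁, hφ₂, fun s t hst =>
    coboundary_ne_of_represents (represents_smul_add_smul hr₁ hr₂ s t) (hne s t hst)⟩

theorem hasRelativeClass_of_card_lt [Fact p.Prime] (h : D ⊆ A)
    (hc : ENat.card (H₁ p D) < ENat.card (H₁ p A)) : HasRelativeClass p h := by
  obtain ⟨f, hf, hf0⟩ := exists_dual_ne_zero (homologyMap p h).hom hc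
  let e : ZMod p ≃ₗ[ZMod p] coeff.{u} p := ULift.moduleEquiv.symm
  obtain ⟨φ, hφ, hr⟩ := exists_relativeCocycle_of_homology h
    (ModuleCat.ofHom (e.toLinearMap ∘ₗ f)) (ModuleCat.hom_ext
      (LinearMap.ext fun w => congrArg e (LinearMap.congr_fun hf0 w)))
  refine ⟨φ, hφ, ?_⟩
  rintro ψ rfl
  have h0 := eq_zero_of_d_comp hr
  refine hf (LinearMap.ext fun v => e.injective ?_)
  exact congrArg (fun k => k.hom v) h0

theorem hasRelativeClassPair_of_card_lt [Fact p.Prime] (h : D ⊆ A)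
    (hc : p * ENat.card (H₁ p D) < ENat.card (H₁ p A)) : HasRelativeClassPair p h := by
  have hp : ENat.card (ZMod p) = p := by
    rw [ENat.card_eq_coe_natCard, Nat.card_zmod]
  obtain ⟨f, g, hf0, hg0, hne⟩ := exists_dual_pair (homologyMap p h).hom (by rwa [hp])
  let e : ZMod p ≃ₗ[ZMod p] coeff.{u} p := ULift.moduleEquiv.symm
  obtain ⟨φ₁, hφ₁, hr₁⟩ := exists_relativeCocycle_of_homology h
    (ModuleCat.ofHom (e.toLinearMap ∘ₗ f)) (ModuleCat.hom_ext
      (LinearMap.ext fun w => congrArg e (LinearMap.congr_fun hf0 w)))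
  obtain ⟨φ₂, hφ₂, hr₂⟩ := exists_relativeCocycle_of_homology h
    (ModuleCat.ofHom (e.toLinearMap ∘ₗ g)) (ModuleCat.hom_ext
      (LinearMap.ext fun w => congrArg e (LinearMap.congr_fun hg0 w)))
  refine ⟨φ₁, φ₂, hφ₁, hφ₂, fun s t hst ψ hψ => hne s t hst ?_⟩
  have hr := iCycles_comp_smul_add_smul hr₁ hr₂ s t
  have h0 := eq_zero_of_d_comp ((congrArg _ hψ).trans hr)
  refine LinearMap.ext fun v => e.injective ?_
  rw [LinearMap.add_apply, map_add, LinearMap.smul_apply, LinearMap.smul_apply, map_smul, map_smul]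
  exact congrArg (fun k => k.hom v) h0

theorem HasRelativeClass.exists_isFullLabelling [Fact p.Prime] {h : D ⊆ A}
    (hc : HasRelativeClass p h) (hB : A ∩ B ⊆ D) :
    ∃ c : C(unitInterval, X) → ZMod p, IsFullLabelling A B c := by
  obtain ⟨φ, hφ, hne⟩ := hc
  exact hφ.exists_isFullLabelling hB hne

theorem HasRelativeClassPair.exists_isFullLabelling [Fact p.Prime] {h : D ⊆ A}
    (hc : HasRelativeClassPair p h) (hB : A ∩ B ⊆ D) :
    ∃ c : C(unitInterval, X) → ZMod p × ZMod p, IsFullLabelling A B c := by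
  obtain ⟨φ₁, φ₂, hφ₁, hφ₂, hne⟩ := hc
  exact hφ₁.exists_isFullLabelling_prod hB hφ₂ hne

/-- The relative classes of `(A, A ∩ B)` and `(B, A ∩ B)` give full labellings, hence surjections of
the fundamental group onto free products. -/
theorem isLargeMod_of_hasRelativeClass [T2Space X] [ConnectedSpace X] [Fact p.Prime]
    (𝒞 : Topology.CWComplex (Set.univ : Set X))
    (hfin : Topology.CWComplex.Finite (Set.univ : Set X))
    (A B : Topology.CWComplex.Subcomplex (Set.univ : Set X))
    (hAB : (A : Set X) ∪ (B : Set X) = Set.univ)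
    (hA : HasRelativeClass p (Set.inter_subset_left : (A : Set X) ∩ B ⊆ A))
    (hB : HasRelativeClass p (Set.inter_subset_right : (A : Set X) ∩ B ⊆ B))
    (h2 : p = 2 → HasRelativeClassPair p (Set.inter_subset_left : (A : Set X) ∩ B ⊆ A) ∨
      HasRelativeClassPair p (Set.inter_subset_right : (A : Set X) ∩ B ⊆ B)) (x : X) :
    IsLargeMod p (FundamentalGroup X x) := by
  have hlA := isLocallyContractible_of_finite (A : Set X)
  have hlB := isLocallyContractible_of_finite (B : Set X)
  have hlAB := isLocallyContractible_subcomplex_inter A B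
  have hlBA := isLocallyContractible_subcomplex_inter B A
  have hBA : (B : Set X) ∪ (A : Set X) = Set.univ := Set.union_comm _ _ ▸ hAB
  have hsub : (B : Set X) ∩ A ⊆ (A : Set X) ∩ B := (Set.inter_comm _ _).subset
  obtain ⟨c, hc⟩ := hA.exists_isFullLabelling subset_rfl
  obtain ⟨d, hd⟩ := hB.exists_isFullLabelling hsub
  refine isLargeMod_of_surjective
    (exists_surjective_coprod A.closed B.closed hAB hlA hlB hlAB hc hd x) fun hp => ?_
  rcases h2 hp with h | h
  · obtain ⟨c', hc'⟩ := h.exists_isFullLabelling subset_rfl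
    exact exists_surjective_coprod A.closed B.closed hAB hlA hlB hlAB hc' hd x
  · obtain ⟨d', hd'⟩ := h.exists_isFullLabelling hsub
    exact exists_surjective_coprod B.closed A.closed hBA hlB hlA hlBA hd' hc x

/-- The form in which a bound `a / min b c < 1 / k` on a ratio of cardinalities is used. -/
theorem mul_lt_of_div_min_lt {a b c : ℕ∞} {k : ℕ} (hk : k ≠ 0) (ha : a ≠ ⊤) (hb : b ≠ 0)
    (hc : c ≠ 0)
    (h : (a : ℝ≥0∞) / min (b : ℝ≥0∞) (c : ℝ≥0∞) < 1 / k) : k * a < b ∧ k * a < c := by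
  have h1 : (a : ℝ≥0∞) < 1 / k * min (b : ℝ≥0∞) (c : ℝ≥0∞) := by
    refine (ENNReal.div_lt_iff (Or.inl ?_) (Or.inr (by simpa using ha))).1 h
    simp [min_eq_iff, hb, hc]
  rw [mul_comm, mul_one_div, ENNReal.lt_div_iff_mul_lt (Or.inl (by simpa using hk))
    (Or.inl (by simp)), lt_min_iff] at h1
  constructor
  · have := h1.1
    rw [mul_comm]
    exact_mod_cast this
  · have := h1.2
    rw [mul_comm]
    exact_mod_cast this

theorem isLargeMod_of_cheegerConstant_lt [T2Space X] [ConnectedSpace X] [Fact p.Prime]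
    (𝒞 : Topology.CWComplex (Set.univ : Set X))
    (h : cheegerConstant p 𝒞 < if p = 2 then (1 / 2 : ℝ≥0∞) else 1) (x : X) :
    IsLargeMod p (FundamentalGroup X x) := by
  obtain ⟨r, ⟨𝒞', A, B, hfin, -, ⟨⟨A, rfl⟩, ⟨B, rfl⟩, hAB⟩, hf, rfl⟩, hr⟩ := sInf_lt_iff.1 h
  have hcard : ∀ (k : ℕ), k ≠ 0 → _ → _ := fun k hk => mul_lt_of_div_min_lt
    (a := ENat.card (H₁ p (A ∩ B : Set X))) (b := ENat.card (H₁ p (A : Set X)))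
    (c := ENat.card (H₁ p (B : Set X))) hk (by simpa using hf)
    (by simp) (by simp)
  have h1 := hcard 1 one_ne_zero (hr.trans_le (by
    split_ifs
    · simp
    · simp))
  rw [Nat.cast_one, one_mul] at h1
  refine isLargeMod_of_hasRelativeClass 𝒞' hfin A B hAB (hasRelativeClass_of_card_lt _ h1.1)
    (hasRelativeClass_of_card_lt _ h1.2) (fun hp => Or.inl ?_) x
  refine hasRelativeClassPair_of_card_lt _ ?_
  rw [if_pos hp] at hr
  subst hp
  exact (hcard 2 two_ne_zero (by simpa using hr)).1

end Complexes
end LargeGroups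

end

theorem theorem3p7 {X : Type u} [TopologicalSpace X] [T2Space X] [ConnectedSpace X]
    [𝒞 : Topology.CWComplex (Set.univ : Set X)] [Topology.CWComplex.Finite (Set.univ : Set X)]
    (p : ℕ) [Fact p.Prime] (x : X) :
    (∀ A B : Topology.CWComplex.Subcomplex (Set.univ : Set X),
      (A : Set X) ∪ (B : Set X) = Set.univ →
      ¬ Function.Injective
        (LargeGroups.restrict p (Set.inter_subset_left : (A : Set X) ∩ (B : Set X) ⊆ (A : Set X))) →
      ¬ Function.Injective
        (LargeGroups.restrict p (Set.inter_subset_right : (A : Set X) ∩ (B : Set X) ⊆ (B : Set X))) →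
      (p = 2 →
        1 < Module.rank (ZMod p) (LinearMap.ker (LargeGroups.restrict p
          (Set.inter_subset_left : (A : Set X) ∩ (B : Set X) ⊆ (A : Set X)))) ∨
        1 < Module.rank (ZMod p) (LinearMap.ker (LargeGroups.restrict p
          (Set.inter_subset_right : (A : Set X) ∩ (B : Set X) ⊆ (B : Set X))))) →
      LargeGroups.IsLargeMod p (FundamentalGroup X x)) ∧
    (LargeGroups.cheegerConstant p 𝒞 < (if p = 2 then (1 / 2 : ℝ≥0∞) else 1) →
      LargeGroups.IsLargeMod p (FundamentalGroup X x)) := by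
  refine ⟨fun A B hAB hA hB h2 => ?_, fun h =>
    LargeGroups.isLargeMod_of_cheegerConstant_lt 𝒞 h x⟩
  exact LargeGroups.isLargeMod_of_hasRelativeClass 𝒞 inferInstance A B hAB
    (LargeGroups.hasRelativeClass_of_not_injective _ hA)
    (LargeGroups.hasRelativeClass_of_not_injective _ hB)
    (fun hp => (h2 hp).imp (LargeGroups.hasRelativeClassPair_of_rank _)
      (LargeGroups.hasRelativeClassPair_of_rank _)) x
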